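/- Let $$\mathcal{A}=\left\{(\alpha,\beta,\gamma)\in\left[0,\tfrac{\pi}{2}\right]^3 : \alpha+\beta+\gamma<\pi\right\}.$$ For $(\alpha,\beta,\gamma)\in\mathcal{A}$ let $S_{\alpha,\beta,\gamma}$ be the triangular surface obtained by gluing two copies of the hyperbolic triangle with angles $\alpha,\beta,\gamma$ along their corresponding sides, with its length metric (a vertex whose angle is $0$ is ideal and gives a cusp; it is not a point of the surface). For a point $p\in S_{\alpha,\beta,\gamma}$ let $B_r(p)$ be the open ball of radius $r$ around $p$, and let $$r_p=\max\{r\ge 0 : B_r(p)\text{ is isometric, for the length structures, to an open disk of radius } r \text{ in } \mathbb{H}^2,\text{ with } p \text{ corresponding to its centre}\}$$ be the injectivity radius at $p$; let $r(S_{\alpha,\beta,\gamma})=\max_{p\in S_{\alpha,\beta,\gamma}} r_p$ be the maximum injectivity radius. Then all these maxima exist, and the map $$\mathcal{A}\to\mathbb{R},\qquad (\alpha,\beta,\gamma)\mapsto r(S_{\alpha,\beta,\gamma}),$$ is continuous. -/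

import Mathlib

/-! ## Injectivity radius -/

/-- The radii `r ≥ 0` for which the open ball `B_r(p)` of the metric surface `M` is isometric to an
open hyperbolic disk of radius `r`.  As usual for surfaces, "isometric" is meant for the length
structures: the isometry is a homeomorphism of the disk (with centre `z`) onto the ball (with
centre `p`) that preserves distances locally.  (The distances of `M` between far apart points of
the ball may be realized by paths that leave the ball.) -/
def embeddedDiskRadii {M : Type*} [MetricSpace M] (p : M) : Set ℝ :=
  {r | 0 ≤ r ∧ ∃ (z : UpperHalfPlane) (φ : Metric.ball z r ≃ₜ Metric.ball p r),
    (∀ x : Metric.ball z r, (x : UpperHalfPlane) = z → (φ x : M) = p) ∧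
    ∀ x : Metric.ball z r, ∃ ε > 0, ∀ y w : Metric.ball z r,
      dist y x < ε → dist w x < ε → dist (φ y) (φ w) = dist y w}

/-- The injectivity radius `r_p` at the point `p`. -/
noncomputable def injRadius {M : Type*} [MetricSpace M] (p : M) : ℝ :=
  sSup (embeddedDiskRadii p)

/-- The maximum injectivity radius `r(M)`. -/
noncomputable def maxInjRadius (M : Type*) [MetricSpace M] : ℝ :=
  ⨆ p : M, injRadius p

/-! ## Geodesic half-planes of the hyperbolic plane -/

/-- The function `a |z|² + b Re z + c` on the upper half-plane, for `n = (a, b, c)`.  If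
`b² - 4ac > 0`, its zero set is a complete geodesic, and every geodesic is of this form; the set
where it is `≤ 0` is one of the two closed half-planes bounded by this geodesic. -/
def geodForm (n : ℝ × ℝ × ℝ) (z : UpperHalfPlane) : ℝ :=
  n.1 * (z.re ^ 2 + z.im ^ 2) + n.2.1 * z.re + n.2.2

/-- The bilinear form polarizing the discriminant `b² - 4ac`. -/
def geodPairing (n n' : ℝ × ℝ × ℝ) : ℝ :=
  n.2.1 * n'.2.1 - 2 * (n.1 * n'.2.2 + n'.1 * n.2.2)

/-- Geometric meaning of `geodPairing`: if two geodesics meet in `z`, then `geodPairing` is the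
Euclidean inner product of the gradients at `z` of the functions that define them, that is, of
outward normals of the two half-planes.  (For `n = n'` it is the squared length of the normal.)
So, if `n` and `n'` have discriminant `1`, the two half-planes form at `z` a wedge of interior
angle `θ` with `geodPairing n n' = - cos θ`; recall that the upper half-plane is conformal. -/
theorem geodPairing_eq_inner_gradients (n n' : ℝ × ℝ × ℝ) (z : UpperHalfPlane)
    (h : geodForm n z = 0) (h' : geodForm n' z = 0) :
    geodPairing n n' =
      (2 * n.1 * z.re + n.2.1) * (2 * n'.1 * z.re + n'.2.1) +
        (2 * n.1 * z.im) * (2 * n'.1 * z.im) := by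
  simp only [geodForm, geodPairing] at *
  linear_combination (-2 * n'.1) * h + (-2 * n.1) * h'

/-! ## Hyperbolic triangles with prescribed angles -/

/-- The set `𝒜` of triples of angles. -/
def angleTriples : Set (ℝ × ℝ × ℝ) :=
  {t | t.1 ∈ Set.Icc 0 (Real.pi / 2) ∧ t.2.1 ∈ Set.Icc 0 (Real.pi / 2) ∧
    t.2.2 ∈ Set.Icc 0 (Real.pi / 2) ∧ t.1 + t.2.1 + t.2.2 < Real.pi}

/-- Auxiliary: `cos γ + cos α cos β`. -/
noncomputable def triK (t : ℝ × ℝ × ℝ) : ℝ :=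
  Real.cos t.2.2 + Real.cos t.1 * Real.cos t.2.1

/-- Auxiliary: the larger root `m` of `m² - 2 (cos γ + cos α cos β) m + sin² α sin² β = 0`. -/
noncomputable def triM (t : ℝ × ℝ × ℝ) : ℝ :=
  triK t + √(triK t ^ 2 - Real.sin t.1 ^ 2 * Real.sin t.2.1 ^ 2)

/-- The side `a = BC`, opposite to `A`: the geodesic `m |z|² - 2 cos β Re z = sin² β / m`, which
makes the angle `β` with the imaginary axis at `B = i sin β / m` (the ideal point `0` if `β = 0`);
the triangle lies above it. -/
noncomputable def sideA (t : ℝ × ℝ × ℝ) : ℝ × ℝ × ℝ :=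
  (-triM t / 2, Real.cos t.2.1, Real.sin t.2.1 ^ 2 / (2 * triM t))

/-- The side `b = AC`, opposite to `B`: the geodesic `sin² α |z|² + 2 cos α Re z = 1`, which makes
the angle `α` with the imaginary axis at `A = i / sin α` (the ideal point `∞` if `α = 0`); the
triangle lies below it. -/
noncomputable def sideB (t : ℝ × ℝ × ℝ) : ℝ × ℝ × ℝ :=
  (Real.sin t.1 ^ 2 / 2, Real.cos t.1, -1 / 2)

/-- The side `c = AB`, opposite to `C`: the imaginary axis; the triangle lies to its right. -/
def sideC : ℝ × ℝ × ℝ := (0, -1, 0)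

/-- The hyperbolic triangle with angles `(α, β, γ) = t ∈ 𝒜` at the vertices `A`, `B`, `C`, placed
in the upper half-plane, as the intersection of three half-planes.  A vertex whose angle is `0`
is ideal, hence is not a point of the triangle.  The lemmas `geodPairing_side…` below verify
that the angles are the prescribed ones. -/
def hypTriangle (t : ℝ × ℝ × ℝ) : Set UpperHalfPlane :=
  {z | geodForm (sideA t) z ≤ 0 ∧ geodForm (sideB t) z ≤ 0 ∧ geodForm sideC z ≤ 0}

/-- The union of the three sides of the triangle. -/
def triangleSides (t : ℝ × ℝ × ℝ) : Set (hypTriangle t) :=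
  {z | geodForm (sideA t) z = 0 ∨ geodForm (sideB t) z = 0 ∨ geodForm sideC z = 0}

theorem triK_gt {t : ℝ × ℝ × ℝ} (ht : t ∈ angleTriples) :
    Real.sin t.1 * Real.sin t.2.1 < triK t := by
  obtain ⟨⟨h1, h1'⟩, ⟨h2, h2'⟩, ⟨h3, h3'⟩, h⟩ := ht
  have h4 : Real.cos (Real.pi - (t.1 + t.2.1)) < Real.cos t.2.2 :=
    Real.cos_lt_cos_of_nonneg_of_le_pi h3 (by linarith) (by linarith)
  rw [Real.cos_pi_sub, Real.cos_add] at h4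
  unfold triK
  linarith

theorem sin_nonneg_of_angle {x : ℝ} (hx : x ∈ Set.Icc 0 (Real.pi / 2)) : 0 ≤ Real.sin x :=
  Real.sin_nonneg_of_nonneg_of_le_pi hx.1 (by linarith [hx.2, Real.pi_pos])

theorem triM_gt {t : ℝ × ℝ × ℝ} (ht : t ∈ angleTriples) :
    Real.sin t.1 * Real.sin t.2.1 < triM t := by
  have := triK_gt ht
  have := Real.sqrt_nonneg (triK t ^ 2 - Real.sin t.1 ^ 2 * Real.sin t.2.1 ^ 2)
  unfold triM
  linarith

theorem triM_pos {t : ℝ × ℝ × ℝ} (ht : t ∈ angleTriples) : 0 < triM t :=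
  lt_of_le_of_lt (mul_nonneg (sin_nonneg_of_angle ht.1) (sin_nonneg_of_angle ht.2.1)) (triM_gt ht)

theorem triM_quadratic {t : ℝ × ℝ × ℝ} (ht : t ∈ angleTriples) :
    triM t ^ 2 - 2 * triK t * triM t + Real.sin t.1 ^ 2 * Real.sin t.2.1 ^ 2 = 0 := by
  have h0 : 0 ≤ Real.sin t.1 * Real.sin t.2.1 :=
    mul_nonneg (sin_nonneg_of_angle ht.1) (sin_nonneg_of_angle ht.2.1)
  have h1 : 0 ≤ triK t ^ 2 - Real.sin t.1 ^ 2 * Real.sin t.2.1 ^ 2 := by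
    nlinarith [triK_gt ht]
  have h2 := Real.sq_sqrt h1
  unfold triM
  linear_combination h2

theorem geodPairing_sideA_self {t : ℝ × ℝ × ℝ} (ht : t ∈ angleTriples) :
    geodPairing (sideA t) (sideA t) = 1 := by
  have hm := (triM_pos ht).ne'
  simp only [geodPairing, sideA]
  field_simp
  have h := Real.sin_sq_add_cos_sq t.2.1
  ring_nf at h ⊢
  linarith

theorem geodPairing_sideB_self (t : ℝ × ℝ × ℝ) : geodPairing (sideB t) (sideB t) = 1 := by
  simp only [geodPairing, sideB]
  linear_combination Real.sin_sq_add_cos_sq t.1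

theorem geodPairing_sideC_self : geodPairing sideC sideC = 1 := by
  norm_num [geodPairing, sideC]

/-- The sides `b` and `c` form the angle `α`. -/
theorem geodPairing_sideB_sideC (t : ℝ × ℝ × ℝ) :
    geodPairing (sideB t) sideC = -Real.cos t.1 := by
  simp [geodPairing, sideB, sideC]

/-- The sides `a` and `c` form the angle `β`. -/
theorem geodPairing_sideA_sideC (t : ℝ × ℝ × ℝ) :
    geodPairing (sideA t) sideC = -Real.cos t.2.1 := by
  simp [geodPairing, sideA, sideC]

/-- The sides `a` and `b` form the angle `γ`. -/
theorem geodPairing_sideA_sideB {t : ℝ × ℝ × ℝ} (ht : t ∈ angleTriples) :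
    geodPairing (sideA t) (sideB t) = -Real.cos t.2.2 := by
  have hm := (triM_pos ht).ne'
  have hq := triM_quadratic ht
  simp only [geodPairing, sideA, sideB]
  field_simp
  unfold triK at hq
  linear_combination -hq

/-- The sides are nonempty, because the side `c` is. -/
instance triangleSides_nonempty (t : angleTriples) : Nonempty (triangleSides t.1) := by
  obtain ⟨t, ht⟩ := t
  have hm := triM_pos ht
  have ha := sin_nonneg_of_angle ht.1
  have hb := sin_nonneg_of_angle ht.2.1
  obtain ⟨y, hy, h1, h2⟩ : ∃ y : ℝ, 0 < y ∧ Real.sin t.1 * y ≤ 1 ∧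
      Real.sin t.2.1 ≤ triM t * y := by
    rcases ha.eq_or_lt with h0 | h0
    · refine ⟨1 + Real.sin t.2.1 / triM t, by positivity, by simp [← h0], ?_⟩
      field_simp
      linarith
    · refine ⟨1 / Real.sin t.1, by positivity, by field_simp; exact le_rfl, ?_⟩
      field_simp
      linarith [triM_gt ht]
  let z : UpperHalfPlane := ⟨⟨0, y⟩, hy⟩
  have hre : z.re = 0 := rfl
  have him : z.im = y := rfl
  have hc : geodForm sideC z = 0 := by simp [geodForm, sideC, hre]
  refine ⟨⟨⟨z, ?_, ?_, hc.le⟩, Or.inr (Or.inr hc)⟩⟩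
  · have h3 : Real.sin t.2.1 ^ 2 ≤ (triM t * y) ^ 2 := by gcongr
    have h4 : Real.sin t.2.1 ^ 2 / (2 * triM t) ≤ triM t / 2 * y ^ 2 := by
      rw [div_le_iff₀ (by positivity)]
      linarith
    simp only [geodForm, sideA, hre, him]
    linarith
  · have h3 : (Real.sin t.1 * y) ^ 2 ≤ 1 := pow_le_one₀ (by positivity) h1
    simp only [geodForm, sideB, hre, him]
    linarith

/-! ## Triangular surfaces -/

/-- The triangular surface `S_{α,β,γ}`: two copies of the triangle with angles `α, β, γ`, glued
along their sides by the identity.  In its metric, two points on the same copy have their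
hyperbolic distance, and points `x`, `y` on different copies have distance
`inf_s (d(x, s) + d(s, y))`, where `s` runs over the points of the sides; since triangles are
convex, this is the length metric of the glued surface. -/
abbrev TriangularSurface (t : angleTriples) : Type :=
  Metric.GlueSpace
    (isometry_subtype_coe : Isometry (Subtype.val : triangleSides t.1 → hypTriangle t.1))
    (isometry_subtype_coe : Isometry (Subtype.val : triangleSides t.1 → hypTriangle t.1))

/-! Write `R_i` for the reflection in side `i`. A geodesic loop at `p` that leaves one copy of the
triangle through side `i` and comes back through side `j` unfolds to the segment between `R_i p` and
`R_j p`. Accordingly `r_p` is half the least distance between two mirror images of `p`. If these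
distances are at least `2r`, unfolding the disk across the sides is well defined, bijective and
locally isometric (`IsDouble.mem_embeddedDiskRadii`). Conversely, a larger disk would contain, on
the other sheet, the midpoint `μ` of a closest pair of mirror images. Two shortest paths join `p` to
it; in a hyperbolic disk they coincide, which forces `μ` to be a vertex. But a vertex is a cone
point of angle at most `π`, without hyperbolic neighbourhoods
(`IsDouble.le_of_mem_embeddedDiskRadii`).

In the hyperboloid model, let `u i` be the hyperbolic sine of the distance to side `i`. The relevant
half distances have squared hyperbolic sine `loopForm`, and the nonnegative solutions of `cosForm u
= cosDet` are exactly the height vectors of points of the triangle (`HypSides.cosForm_ht`,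
`HypSides.exists_ht_eq`). By homogeneity, `sinh² r(S)` is `cosDet` times the maximum of `loopMin /
cosForm` over a fixed compact simplex, so continuity reduces to joint continuity of this quotient.
The delicate points are the corners belonging to ideal vertices, where `cosForm` vanishes; there
`mul_sqrt_loopMin_le_cosForm` shows that the quotient tends to `0`. -/

/-! ## The hyperboloid model -/

/-- The Lorentzian bilinear form on `ℝ³`, of signature `(1, 2)`. -/
noncomputable def mink (v w : ℝ × ℝ × ℝ) : ℝ :=
  (v.1 * w.2.2 + v.2.2 * w.1) / 2 - v.2.1 * w.2.1

/-- The point of the hyperboloid `mink v v = 1` that corresponds to a point of the upper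
half-plane. -/
noncomputable def hypVec (z : UpperHalfPlane) : ℝ × ℝ × ℝ :=
  ((z.re ^ 2 + z.im ^ 2) / z.im, z.re / z.im, 1 / z.im)

/-- The vector that represents the functional `geodForm n` with respect to `mink`. -/
def sharp (n : ℝ × ℝ × ℝ) : ℝ × ℝ × ℝ := (2 * n.2.2, -n.2.1, 2 * n.1)

/-- If `n` has discriminant `1`, the hyperbolic sine of the signed distance to the geodesic `n`,
positive on the half-plane `geodForm n < 0`. -/
noncomputable def ht (n : ℝ × ℝ × ℝ) (z : UpperHalfPlane) : ℝ := -mink (sharp n) (hypVec z)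

theorem mink_comm (v w : ℝ × ℝ × ℝ) : mink v w = mink w v := by
  simp only [mink]; ring

theorem mink_add_left (v v' w : ℝ × ℝ × ℝ) : mink (v + v') w = mink v w + mink v' w := by
  simp only [mink, Prod.fst_add, Prod.snd_add]; ring

theorem mink_smul_left (c : ℝ) (v w : ℝ × ℝ × ℝ) : mink (c • v) w = c * mink v w := by
  simp only [mink, Prod.smul_fst, Prod.smul_snd, smul_eq_mul]; ring

theorem mink_sub_left (v v' w : ℝ × ℝ × ℝ) : mink (v - v') w = mink v w - mink v' w := by
  simp only [mink, Prod.fst_sub, Prod.snd_sub]; ring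

theorem mink_add_right (v w w' : ℝ × ℝ × ℝ) : mink v (w + w') = mink v w + mink v w' := by
  simp only [mink, Prod.fst_add, Prod.snd_add]; ring

theorem mink_smul_right (c : ℝ) (v w : ℝ × ℝ × ℝ) : mink v (c • w) = c * mink v w := by
  simp only [mink, Prod.smul_fst, Prod.smul_snd, smul_eq_mul]; ring

theorem mink_sub_right (v w w' : ℝ × ℝ × ℝ) : mink v (w - w') = mink v w - mink v w' := by
  simp only [mink, Prod.fst_sub, Prod.snd_sub]; ring

theorem mink_sharp_sharp (n n' : ℝ × ℝ × ℝ) : mink (sharp n) (sharp n') = -geodPairing n n' := by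
  simp only [mink, sharp, geodPairing]; ring

theorem geodPairing_comm (n n' : ℝ × ℝ × ℝ) : geodPairing n n' = geodPairing n' n := by
  simp only [geodPairing]; ring

theorem ht_eq (n : ℝ × ℝ × ℝ) (z : UpperHalfPlane) : ht n z = -geodForm n z / z.im := by
  have := z.im_pos.ne'
  simp only [ht, mink, sharp, hypVec, geodForm]
  field_simp
  ring

theorem ht_nonneg_iff (n : ℝ × ℝ × ℝ) (z : UpperHalfPlane) : 0 ≤ ht n z ↔ geodForm n z ≤ 0 := by
  rw [ht_eq, le_div_iff₀ z.im_pos]; simp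

theorem ht_eq_zero_iff (n : ℝ × ℝ × ℝ) (z : UpperHalfPlane) : ht n z = 0 ↔ geodForm n z = 0 := by
  rw [ht_eq, div_eq_zero_iff]; simp [z.im_pos.ne']

theorem continuous_ht (n : ℝ × ℝ × ℝ) : Continuous (ht n) := by
  have h : ht n = fun z => -geodForm n z / z.im := funext (ht_eq n)
  rw [h]
  unfold geodForm
  have h1 := UpperHalfPlane.continuous_re
  have h2 := UpperHalfPlane.continuous_im
  exact Continuous.div (by fun_prop) h2 fun z => z.im_pos.ne'

theorem cosh_dist_eq_mink (z w : UpperHalfPlane) :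
    Real.cosh (dist z w) = mink (hypVec z) (hypVec w) := by
  have hz := z.im_pos.ne'
  have hw := w.im_pos.ne'
  rw [UpperHalfPlane.cosh_dist']
  simp only [mink, hypVec]
  field_simp
  ring

theorem mink_hypVec_self (z : UpperHalfPlane) : mink (hypVec z) (hypVec z) = 1 := by
  rw [← cosh_dist_eq_mink, dist_self, Real.cosh_zero]

theorem cosh_le_cosh_dist {z w z' w' : UpperHalfPlane} :
    dist z w ≤ dist z' w' ↔ mink (hypVec z) (hypVec w) ≤ mink (hypVec z') (hypVec w') := by
  rw [← cosh_dist_eq_mink, ← cosh_dist_eq_mink, Real.cosh_le_cosh, abs_of_nonneg dist_nonneg,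
    abs_of_nonneg dist_nonneg]

theorem dist_eq_of_mink_eq {z w z' w' : UpperHalfPlane}
    (h : mink (hypVec z) (hypVec w) = mink (hypVec z') (hypVec w')) : dist z w = dist z' w' :=
  le_antisymm (cosh_le_cosh_dist.2 h.le) (cosh_le_cosh_dist.2 h.ge)

theorem dist_eq_of_mink_eq_cosh {z w : UpperHalfPlane} {L : ℝ} (hL : 0 ≤ L)
    (h : mink (hypVec z) (hypVec w) = Real.cosh L) : dist z w = L := by
  rw [← cosh_dist_eq_mink] at h
  have := le_antisymm (Real.cosh_le_cosh.1 h.le) (Real.cosh_le_cosh.1 h.ge)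
  rwa [abs_of_nonneg dist_nonneg, abs_of_nonneg hL] at this

theorem hypVec_injective : Function.Injective hypVec := by
  intro z w h
  rw [← dist_eq_zero]
  apply dist_eq_of_mink_eq_cosh le_rfl
  rw [h, mink_hypVec_self, Real.cosh_zero]

/-- A timelike vector on the same side of the light cone as a point of the hyperboloid is, up to
normalization, a point of the hyperboloid. -/
theorem exists_hypVec_eq {v : ℝ × ℝ × ℝ} (hv : 0 < mink v v) {z : UpperHalfPlane}
    (hz : 0 < mink v (hypVec z)) : ∃ w, hypVec w = (√(mink v v))⁻¹ • v := by
  have hs : 0 < √(mink v v) := Real.sqrt_pos.2 hv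
  have hsq := Real.sq_sqrt hv.le
  obtain ⟨a, b, c⟩ := v
  have hy := z.im_pos
  have hv' : b ^ 2 < a * c := by simp only [mink] at hv; nlinarith
  have h3 : 0 < c := by
    by_contra hc
    have hc' : c < 0 := lt_of_le_of_ne (not_lt.1 hc) (by rintro rfl; nlinarith [sq_nonneg b])
    have h1 : 0 < (a + c * (z.re ^ 2 + z.im ^ 2) - 2 * b * z.re) := by
      have h2 : mink (a, b, c) (hypVec z) =
          (a + c * (z.re ^ 2 + z.im ^ 2) - 2 * b * z.re) / (2 * z.im) := by
        simp only [mink, hypVec]; field_simp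
      rw [h2] at hz
      exact (div_pos_iff_of_pos_right (by positivity)).1 hz
    -- Completing squares, this product is `(a c - b²) + (c re - b)² + (c im)²`, which is positive.
    have h4 := mul_neg_of_pos_of_neg h1 hc'
    nlinarith [sq_nonneg (c * z.re - b), sq_nonneg (c * z.im)]
  set N := √(mink (a, b, c) (a, b, c)) with hN
  refine ⟨⟨⟨b / c, N / c⟩, div_pos hs h3⟩, ?_⟩
  have hre : (⟨⟨b / c, N / c⟩, div_pos hs h3⟩ : UpperHalfPlane).re = b / c := rfl
  have him : (⟨⟨b / c, N / c⟩, div_pos hs h3⟩ : UpperHalfPlane).im = N / c := rfl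
  simp only [hypVec, hre, him, Prod.smul_mk, smul_eq_mul, Prod.mk.injEq]
  have h5 : N ^ 2 = a * c - b ^ 2 := by rw [hsq]; simp only [mink]; ring
  refine ⟨?_, ?_, ?_⟩
  · field_simp
    linear_combination h5
  · field_simp
  · field_simp

theorem exists_hypVec_eq_of_unit {v : ℝ × ℝ × ℝ} (hv : mink v v = 1) {z : UpperHalfPlane}
    (hz : 0 < mink v (hypVec z)) : ∃ w, hypVec w = v := by
  obtain ⟨w, hw⟩ := exists_hypVec_eq (hv ▸ one_pos) hz
  exact ⟨w, by simpa [hv] using hw⟩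

/-! ## Reflections -/

/-- The Lorentz reflection preserves `mink`, and the reflected vector pairs with `hypVec z` to `1 +
2 (ht n z)²`, so it stays on the same sheet of the hyperboloid. -/
theorem exists_refl {n : ℝ × ℝ × ℝ} (hn : geodPairing n n = 1) (z : UpperHalfPlane) :
    ∃ w, hypVec w = hypVec z - (2 * ht n z) • sharp n := by
  have h1 : mink (sharp n) (hypVec z) = -ht n z := by simp [ht]
  apply exists_hypVec_eq_of_unit (z := z)
  · simp only [mink_sub_left, mink_sub_right, mink_smul_left, mink_smul_right, mink_hypVec_self,
      mink_sharp_sharp, hn, mink_comm (hypVec z), h1]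
    ring
  · simp only [mink_sub_left, mink_smul_left, mink_hypVec_self, h1]
    nlinarith [sq_nonneg (ht n z)]

open Classical in
/-- The reflection of the hyperbolic plane in the geodesic `n` of discriminant `1`. -/
noncomputable def hypRefl (n : ℝ × ℝ × ℝ) (z : UpperHalfPlane) : UpperHalfPlane :=
  if h : geodPairing n n = 1 then (exists_refl h z).choose else z

theorem hypVec_hypRefl {n : ℝ × ℝ × ℝ} (hn : geodPairing n n = 1) (z : UpperHalfPlane) :
    hypVec (hypRefl n z) = hypVec z - (2 * ht n z) • sharp n := by
  rw [hypRefl, dif_pos hn]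
  exact (exists_refl hn z).choose_spec

/-- Source of all comparisons between a point and its mirror image: the sign of the product of the
heights decides which of the two is closer to `w`. -/
theorem mink_hypVec_hypRefl {n : ℝ × ℝ × ℝ} (hn : geodPairing n n = 1) (z w : UpperHalfPlane) :
    mink (hypVec (hypRefl n z)) (hypVec w) =
      mink (hypVec z) (hypVec w) + 2 * (ht n z * ht n w) := by
  rw [hypVec_hypRefl hn, mink_sub_left, mink_smul_left]
  simp only [ht]
  ring

theorem ht_hypRefl {n : ℝ × ℝ × ℝ} (hn : geodPairing n n = 1) (n' : ℝ × ℝ × ℝ)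
    (z : UpperHalfPlane) : ht n' (hypRefl n z) = ht n' z - 2 * geodPairing n' n * ht n z := by
  rw [ht, hypVec_hypRefl hn, mink_sub_right, mink_smul_right, mink_sharp_sharp]
  simp only [ht]
  ring

theorem ht_hypRefl_self {n : ℝ × ℝ × ℝ} (hn : geodPairing n n = 1) (z : UpperHalfPlane) :
    ht n (hypRefl n z) = -ht n z := by
  rw [ht_hypRefl hn, hn]; ring

theorem hypRefl_hypRefl {n : ℝ × ℝ × ℝ} (hn : geodPairing n n = 1) (z : UpperHalfPlane) :
    hypRefl n (hypRefl n z) = z := by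
  apply hypVec_injective
  rw [hypVec_hypRefl hn, ht_hypRefl_self hn, hypVec_hypRefl hn]
  simp

theorem hypRefl_eq_self {n : ℝ × ℝ × ℝ} (hn : geodPairing n n = 1) {z : UpperHalfPlane}
    (h : ht n z = 0) : hypRefl n z = z := by
  apply hypVec_injective
  rw [hypVec_hypRefl hn, h]
  simp

theorem dist_hypRefl_left {n : ℝ × ℝ × ℝ} (hn : geodPairing n n = 1) (z w : UpperHalfPlane) :
    dist (hypRefl n z) w = dist z (hypRefl n w) := by
  apply dist_eq_of_mink_eq
  rw [mink_hypVec_hypRefl hn, mink_comm (hypVec z) (hypVec (hypRefl n w)), mink_hypVec_hypRefl hn,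
    mink_comm (hypVec w)]
  ring

theorem dist_hypRefl_hypRefl {n : ℝ × ℝ × ℝ} (hn : geodPairing n n = 1) (z w : UpperHalfPlane) :
    dist (hypRefl n z) (hypRefl n w) = dist z w := by
  rw [dist_hypRefl_left hn, hypRefl_hypRefl hn]

theorem dist_le_dist_hypRefl {n : ℝ × ℝ × ℝ} (hn : geodPairing n n = 1) {z w : UpperHalfPlane}
    (h : 0 ≤ ht n z * ht n w) : dist z w ≤ dist (hypRefl n z) w := by
  rw [cosh_le_cosh_dist, mink_hypVec_hypRefl hn]
  linarith

theorem dist_hypRefl_le_dist {n : ℝ × ℝ × ℝ} (hn : geodPairing n n = 1) {z w : UpperHalfPlane}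
    (h : ht n z * ht n w ≤ 0) : dist (hypRefl n z) w ≤ dist z w := by
  rw [cosh_le_cosh_dist, mink_hypVec_hypRefl hn]
  linarith

theorem dist_hypRefl_lt_dist {n : ℝ × ℝ × ℝ} (hn : geodPairing n n = 1) {z w : UpperHalfPlane}
    (h : ht n z * ht n w < 0) : dist (hypRefl n z) w < dist z w := by
  rw [lt_iff_not_ge, cosh_le_cosh_dist, mink_hypVec_hypRefl hn]
  linarith

/-! ## Midpoints and geodesic segments -/

theorem one_le_mink_hypVec (x y : UpperHalfPlane) : 1 ≤ mink (hypVec x) (hypVec y) := by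
  rw [← cosh_dist_eq_mink]; exact Real.one_le_cosh _

/-- Existence and uniqueness of midpoints. -/
theorem exists_midpoint (x y : UpperHalfPlane) :
    ∃ f, hypVec f = (2 * Real.cosh (dist x y / 2))⁻¹ • (hypVec x + hypVec y) ∧
      dist x f = dist x y / 2 ∧ dist y f = dist x y / 2 ∧
      ∀ q, dist x q ≤ dist x y / 2 → dist y q ≤ dist x y / 2 → q = f := by
  set C := Real.cosh (dist x y / 2) with hC
  have hC0 : 0 < C := Real.cosh_pos _
  have hd : mink (hypVec x) (hypVec y) = 2 * C ^ 2 - 1 := by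
    rw [← cosh_dist_eq_mink, show dist x y = 2 * (dist x y / 2) by ring, Real.cosh_two_mul,
      Real.sinh_sq]
    ring
  obtain ⟨f, hf⟩ : ∃ f, hypVec f = (2 * C)⁻¹ • (hypVec x + hypVec y) := by
    apply exists_hypVec_eq_of_unit (z := x)
    · simp only [mink_add_left, mink_add_right, mink_smul_left, mink_smul_right, mink_hypVec_self,
        mink_comm (hypVec y) (hypVec x), hd]
      field_simp
      ring
    · simp only [mink_add_left, mink_smul_left, mink_hypVec_self, mink_comm (hypVec y) (hypVec x)]
      have := one_le_mink_hypVec x y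
      positivity
  -- The pairing with `f` averages those with `x` and `y`; for `q` within half the distance of both
  -- it is at most `1`, which forces `q = f`.
  have hq : ∀ q, mink (hypVec q) (hypVec f) =
      (2 * C)⁻¹ * (mink (hypVec x) (hypVec q) + mink (hypVec y) (hypVec q)) := by
    intro q
    rw [hf, mink_smul_right, mink_add_right, mink_comm (hypVec q), mink_comm (hypVec q)]
  have h0 : 0 ≤ dist x y / 2 := by positivity
  refine ⟨f, hf, ?_, ?_, ?_⟩
  · apply dist_eq_of_mink_eq_cosh h0
    rw [hq, mink_hypVec_self, mink_comm, hd]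
    field_simp
    ring
  · apply dist_eq_of_mink_eq_cosh h0
    rw [hq, mink_hypVec_self, hd]
    field_simp
    ring
  · intro q h1 h2
    have h1' : mink (hypVec x) (hypVec q) ≤ C := by
      rw [← cosh_dist_eq_mink]
      exact Real.cosh_le_cosh.2 (by rwa [abs_of_nonneg dist_nonneg, abs_of_nonneg h0])
    have h2' : mink (hypVec y) (hypVec q) ≤ C := by
      rw [← cosh_dist_eq_mink]
      exact Real.cosh_le_cosh.2 (by rwa [abs_of_nonneg dist_nonneg, abs_of_nonneg h0])
    rw [← dist_eq_zero]
    apply dist_eq_of_mink_eq_cosh le_rfl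
    rw [Real.cosh_zero]
    apply le_antisymm _ (one_le_mink_hypVec _ _)
    rw [hq, inv_mul_le_iff₀ (by positivity)]
    linarith

/-- The geodesic segment from `x` to `y`, parametrized by arc length and constant outside
`[0, dist x y]`.  It stays in every half-plane that contains `x` and `y`. -/
theorem exists_segment (x y : UpperHalfPlane) :
    ∃ g : ℝ → UpperHalfPlane, LipschitzWith 1 g ∧ g 0 = x ∧ g (dist x y) = y ∧
      (∀ τ, dist x (g τ) ≤ dist x y) ∧
      ∀ n τ, 0 ≤ ht n x → 0 ≤ ht n y → 0 ≤ ht n (g τ) := by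
  rcases eq_or_ne x y with rfl | hxy
  · exact ⟨fun _ => x, LipschitzWith.const' x, rfl, rfl, fun _ => le_rfl, fun n τ h _ => h⟩
  set L := dist x y with hL
  have hL0 : 0 < L := dist_pos.2 hxy
  have hS : 0 < Real.sinh L := Real.sinh_pos_iff.2 hL0
  have hC := Real.cosh_sq L
  have hd : mink (hypVec x) (hypVec y) = Real.cosh L := (cosh_dist_eq_mink x y).symm
  -- Hyperbolic analogue of spherical linear interpolation; for `0 ≤ τ ≤ L` both coefficients are
  -- nonnegative, hence the segment stays in half-planes.
  have hg : ∀ τ : ℝ, ∃ w, hypVec w = (Real.sinh L)⁻¹ •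
      (Real.sinh (L - τ) • hypVec x + Real.sinh τ • hypVec y) := by
    intro τ
    have hC' := Real.cosh_sq τ
    apply exists_hypVec_eq_of_unit (z := x)
    · simp only [mink_add_left, mink_add_right, mink_smul_left, mink_smul_right, mink_hypVec_self,
        mink_comm (hypVec y) (hypVec x), hd, Real.sinh_sub]
      field_simp
      have h2 : Real.cosh τ ^ 2 - Real.sinh τ ^ 2 = 1 := Real.cosh_sq_sub_sinh_sq τ
      linear_combination (-Real.sinh τ ^ 2) * hC + Real.sinh L ^ 2 * h2
    · simp only [mink_add_left, mink_smul_left, mink_hypVec_self, mink_comm (hypVec y) (hypVec x),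
        hd, Real.sinh_sub]
      have h3 := Real.cosh_pos τ
      have h4 : (Real.sinh L)⁻¹ * ((Real.sinh L * Real.cosh τ - Real.cosh L * Real.sinh τ) * 1 +
          Real.sinh τ * Real.cosh L) = Real.cosh τ := by
        field_simp
        ring
      rw [h4]
      exact h3
  choose g hg using hg
  have hiso : ∀ τ τ', dist (g τ) (g τ') = |τ - τ'| := by
    intro τ τ'
    apply dist_eq_of_mink_eq_cosh (abs_nonneg _)
    rw [Real.cosh_abs, hg, hg]
    simp only [mink_add_left, mink_add_right, mink_smul_left, mink_smul_right, mink_hypVec_self,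
      mink_comm (hypVec y) (hypVec x), hd, Real.sinh_sub, Real.cosh_sub]
    field_simp
    linear_combination (-Real.sinh τ * Real.sinh τ') * hC
  have h0 : g 0 = x := by
    apply hypVec_injective
    rw [hg]
    simp only [sub_zero, Real.sinh_zero, zero_smul, add_zero, smul_smul]
    rw [inv_mul_cancel₀ hS.ne', one_smul]
  have h1 : g L = y := by
    apply hypVec_injective
    rw [hg]
    simp only [sub_self, Real.sinh_zero, zero_smul, zero_add, smul_smul]
    rw [inv_mul_cancel₀ hS.ne', one_smul]
  refine ⟨fun τ => g (max 0 (min L τ)), ?_, ?_, ?_, ?_, ?_⟩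
  · refine LipschitzWith.of_dist_le_mul fun τ τ' => ?_
    rw [hiso, NNReal.coe_one, one_mul, Real.dist_eq]
    refine (abs_max_sub_max_le_max _ _ _ _).trans ?_
    rw [sub_self, abs_zero, max_eq_right (abs_nonneg _)]
    refine (abs_min_sub_min_le_max _ _ _ _).trans ?_
    rw [sub_self, abs_zero, max_eq_right (abs_nonneg _)]
  · simp [hL0.le, h0]
  · simp [hL0.le, h1]
  · intro τ
    nth_rewrite 1 [← h0]
    rw [hiso, zero_sub, abs_neg, abs_of_nonneg (le_max_left _ _)]
    exact max_le hL0.le (min_le_left _ _)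
  · intro n τ hx hy
    change 0 ≤ ht n (g (max 0 (min L τ)))
    have ha : 0 ≤ max 0 (min L τ) := le_max_left _ _
    have hb : max 0 (min L τ) ≤ L := max_le hL0.le (min_le_left _ _)
    generalize max 0 (min L τ) = σ at ha hb ⊢
    have h2 : ht n (g σ) =
        (Real.sinh L)⁻¹ * (Real.sinh (L - σ) * ht n x + Real.sinh σ * ht n y) := by
      rw [ht, hg, mink_smul_right, mink_add_right, mink_smul_right, mink_smul_right]
      simp only [ht]
      ring
    rw [h2]
    have h3 : 0 ≤ Real.sinh (L - σ) := Real.sinh_nonneg_iff.2 (by linarith)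
    have h4 : 0 ≤ Real.sinh σ := Real.sinh_nonneg_iff.2 ha
    positivity

/-! ## Doubles of nonobtuse triangles -/

/-- The normals of the sides of a triangle without obtuse angles: they are unit vectors, and have
nonnegative inner products up to sign. -/
structure NonobtuseSides (n : Fin 3 → ℝ × ℝ × ℝ) : Prop where
  unit : ∀ i, geodPairing (n i) (n i) = 1
  nonpos : ∀ i j, i ≠ j → geodPairing (n i) (n j) ≤ 0

/-- The intersection of the half-planes given by `n`. -/
def chamber (n : Fin 3 → ℝ × ℝ × ℝ) : Set UpperHalfPlane := {z | ∀ i, 0 ≤ ht (n i) z}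

/-- The metric space `S` consists of two copies `sheet true` and `sheet false` of the chamber `n`,
and the distance of points on different copies is the length of the shortest segment that
connects them through one of the sides. -/
structure IsDouble (n : Fin 3 → ℝ × ℝ × ℝ) {S : Type*} [MetricSpace S]
    (sheet : Bool → UpperHalfPlane → S) : Prop where
  surj : ∀ X, ∃ s, ∃ p ∈ chamber n, sheet s p = X
  dist_same : ∀ s, ∀ p ∈ chamber n, ∀ q ∈ chamber n, dist (sheet s p) (sheet s q) = dist p q
  dist_le : ∀ s, ∀ p ∈ chamber n, ∀ q ∈ chamber n, ∀ i,
    dist (sheet s p) (sheet (!s) q) ≤ dist (hypRefl (n i) p) q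
  exists_eq : ∀ s, ∀ p ∈ chamber n, ∀ q ∈ chamber n, ∃ i,
    dist (sheet s p) (sheet (!s) q) = dist (hypRefl (n i) p) q

/-- The segment from a point of the chamber to the mirror image of another one crosses the side
inside the chamber. -/
theorem NonobtuseSides.exists_crossing {n : Fin 3 → ℝ × ℝ × ℝ} (hn : NonobtuseSides n)
    {p q : UpperHalfPlane} (hp : p ∈ chamber n) (hq : q ∈ chamber n) (i : Fin 3) :
    ∃ x ∈ chamber n, ht (n i) x = 0 ∧ dist p x + dist x q ≤ dist (hypRefl (n i) p) q := by
  rw [dist_hypRefl_left (hn.unit i)]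
  obtain ⟨g, hg, h0, h1, -, hpos⟩ := exists_segment p (hypRefl (n i) q)
  set L := dist p (hypRefl (n i) q) with hL
  have hL0 : 0 ≤ L := dist_nonneg
  obtain ⟨τ, hτ, hτ0⟩ : ∃ τ ∈ Set.Icc 0 L, ht (n i) (g τ) = 0 := by
    have hc : ContinuousOn (fun τ => ht (n i) (g τ)) (Set.Icc 0 L) :=
      ((continuous_ht _).comp hg.continuous).continuousOn
    have := intermediate_value_Icc' hL0 hc
    apply this
    rw [h0, h1, ht_hypRefl_self (hn.unit i)]
    exact ⟨by simpa using hq i, hp i⟩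
  refine ⟨g τ, fun j => ?_, hτ0, ?_⟩
  · rcases eq_or_ne j i with rfl | hj
    · exact hτ0.ge
    -- Absence of obtuse angles enters here: the mirror image of `q` in side `i` remains on the
    -- inner side of the other two sides.
    · apply hpos _ _ (hp j)
      rw [ht_hypRefl (hn.unit i)]
      nlinarith [hn.nonpos j i hj, hq i, hq j, mul_nonneg (neg_nonneg.2 (hn.nonpos j i hj)) (hq i)]
  · have h2 : dist (g τ) q = dist (g τ) (hypRefl (n i) q) := by
      nth_rewrite 1 [← hypRefl_eq_self (hn.unit i) hτ0]
      rw [dist_hypRefl_left (hn.unit i)]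
    have h3 := hg.dist_le_mul 0 τ
    have h4 := hg.dist_le_mul τ L
    rw [h0, Real.dist_eq, zero_sub, abs_neg, abs_of_nonneg hτ.1] at h3
    rw [h1, Real.dist_eq, abs_sub_comm, abs_of_nonneg (by linarith [hτ.2])] at h4
    simp only [NNReal.coe_one, one_mul] at h3 h4
    rw [h2]
    linarith

/-! ### Unfolding balls into the hyperbolic plane -/

/-- The point `X` of the surface is reached from `sheet s` by unfolding to the point `x` of the
hyperbolic plane. -/
def Unfolds {S : Type*} (n : Fin 3 → ℝ × ℝ × ℝ) (sheet : Bool → UpperHalfPlane → S) (s : Bool)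
    (x : UpperHalfPlane) (X : S) : Prop :=
  (x ∈ chamber n ∧ X = sheet s x) ∨
    ∃ i, hypRefl (n i) x ∈ chamber n ∧ X = sheet (!s) (hypRefl (n i) x)

/-- The mirror images of `p` have mutual distances at least `2 r`. -/
def Separated (n : Fin 3 → ℝ × ℝ × ℝ) (p : UpperHalfPlane) (r : ℝ) : Prop :=
  ∀ i j, i ≠ j → 2 * r ≤ dist (hypRefl (n i) p) (hypRefl (n j) p)

section Double

variable {n : Fin 3 → ℝ × ℝ × ℝ} {S : Type*} [MetricSpace S] {sheet : Bool → UpperHalfPlane → S}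

/-- The points of the sides are on both sheets. -/
theorem IsDouble.sheet_eq (hS : IsDouble n sheet) (hn : NonobtuseSides n) (s : Bool)
    {p : UpperHalfPlane} (hp : p ∈ chamber n) {i : Fin 3} (hi : ht (n i) p = 0) :
    sheet s p = sheet (!s) p := by
  rw [← dist_le_zero]
  refine (hS.dist_le s p hp p hp i).trans ?_
  rw [hypRefl_eq_self (hn.unit i) hi, dist_self]

/-- The balls of radius `r` around the mirror images are disjoint. This is what determines the side
through which a nearby point is reached. -/
theorem Separated.eq_of_dist_lt {p : UpperHalfPlane} {r : ℝ} (h : Separated n p r)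
    {x : UpperHalfPlane} {i j : Fin 3} (hi : dist (hypRefl (n i) p) x < r)
    (hj : dist (hypRefl (n j) p) x < r) : i = j := by
  by_contra hij
  have h1 := h i j hij
  have h2 := dist_triangle_right (hypRefl (n i) p) (hypRefl (n j) p) x
  linarith

theorem dist_hypRefl_le_of_ht_nonpos (hn : NonobtuseSides n) {p x : UpperHalfPlane}
    (hp : p ∈ chamber n) {i : Fin 3} (hx : ht (n i) x ≤ 0) :
    dist (hypRefl (n i) p) x ≤ dist p x :=
  dist_hypRefl_le_dist (hn.unit i) (mul_nonpos_of_nonneg_of_nonpos (hp i) hx)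

theorem dist_le_dist_hypRefl_of_mem (hn : NonobtuseSides n) {p x : UpperHalfPlane}
    (hp : p ∈ chamber n) {i : Fin 3} (hx : 0 ≤ ht (n i) x) :
    dist p x ≤ dist (hypRefl (n i) p) x :=
  dist_le_dist_hypRefl (hn.unit i) (mul_nonneg (hp i) hx)

theorem ht_nonpos_of_hypRefl_mem (hn : NonobtuseSides n) {x : UpperHalfPlane} {i : Fin 3}
    (h : hypRefl (n i) x ∈ chamber n) : ht (n i) x ≤ 0 := by
  have := h i
  rw [ht_hypRefl_self (hn.unit i)] at this
  linarith

/-- If `x` lies beyond side `i`, one reflection must bring it back into the chamber: were `R_i x`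
beyond another side `j`, it would be within `r` of both `R_i p` and `R_j p`. -/
theorem exists_unfolds {S' : Type*} (hn : NonobtuseSides n)
    (sheet : Bool → UpperHalfPlane → S') (s : Bool)
    {p : UpperHalfPlane} (hp : p ∈ chamber n) {r : ℝ} (hr : Separated n p r)
    {x : UpperHalfPlane} (hx : dist p x < r) : ∃ X, Unfolds n sheet s x X := by
  by_cases h : x ∈ chamber n
  · exact ⟨_, Or.inl ⟨h, rfl⟩⟩
  simp only [chamber, Set.mem_ofPred_eq, not_forall, not_le] at h
  obtain ⟨i, hi⟩ := h
  refine ⟨_, Or.inr ⟨i, fun j => ?_, rfl⟩⟩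
  rcases eq_or_ne j i with rfl | hj
  · rw [ht_hypRefl_self (hn.unit j)]
    linarith
  by_contra! hneg
  apply hj
  have h1 : dist (hypRefl (n i) p) (hypRefl (n i) x) < r := by
    rwa [dist_hypRefl_hypRefl (hn.unit i)]
  refine hr.eq_of_dist_lt ?_ h1
  refine (dist_hypRefl_le_of_ht_nonpos hn hp hneg.le).trans_lt (lt_of_le_of_lt ?_ h1)
  apply dist_le_dist_hypRefl_of_mem hn hp
  rw [ht_hypRefl_self (hn.unit i)]
  linarith

/-- Only two points reached through sides need the distance bounds: they force the two sides to
agree. Across sheets, every side gives an upper bound. -/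
theorem IsDouble.dist_le_of_unfolds (hS : IsDouble n sheet) (hn : NonobtuseSides n) {s : Bool}
    {p : UpperHalfPlane} (hp : p ∈ chamber n) {r : ℝ} (hr : Separated n p r)
    {x y : UpperHalfPlane} {X Y : S} (hX : Unfolds n sheet s x X) (hY : Unfolds n sheet s y Y)
    (hx : dist p x + dist x y < r) (hy : dist p y + dist x y < r) : dist X Y ≤ dist x y := by
  have h0 : 0 ≤ dist x y := dist_nonneg
  rcases hX with ⟨hxT, rfl⟩ | ⟨i, hxT, rfl⟩ <;> rcases hY with ⟨hyT, rfl⟩ | ⟨j, hyT, rfl⟩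
  · exact (hS.dist_same s x hxT y hyT).le
  · refine (hS.dist_le s x hxT _ hyT j).trans ?_
    rw [dist_hypRefl_hypRefl (hn.unit j)]
  · rw [dist_comm, dist_comm x]
    refine (hS.dist_le s y hyT _ hxT i).trans ?_
    rw [dist_hypRefl_hypRefl (hn.unit i)]
  · rw [hS.dist_same _ _ hxT _ hyT]
    obtain rfl : i = j := by
      have h1 := dist_hypRefl_le_of_ht_nonpos hn hp (ht_nonpos_of_hypRefl_mem hn hxT)
      have h2 := dist_hypRefl_le_of_ht_nonpos hn hp (ht_nonpos_of_hypRefl_mem hn hyT)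
      by_contra hij
      have h3 := hr i j hij
      have h4 := dist_triangle_right (hypRefl (n i) p) (hypRefl (n j) p) x
      have h5 := dist_triangle_right (hypRefl (n j) p) x y
      linarith
    rw [dist_hypRefl_hypRefl (hn.unit i)]

/-- The side that realizes the distance must be the one used for unfolding, since otherwise a point
is within `r` of two mirror images. The bounds involve `dist X Y` rather than `dist x y`, so that
the lemma yields injectivity and continuity of the inverse. -/
theorem IsDouble.dist_eq_of_unfolds (hS : IsDouble n sheet) (hn : NonobtuseSides n) {s : Bool}
    {p : UpperHalfPlane} {r : ℝ} (hr : Separated n p r)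
    {x y : UpperHalfPlane} {X Y : S} (hX : Unfolds n sheet s x X) (hY : Unfolds n sheet s y Y)
    (hx : dist p x + dist X Y < r) (hy : dist p y + dist X Y < r) : dist X Y = dist x y := by
  have h0 : 0 ≤ dist X Y := dist_nonneg
  have mixed : ∀ x ∈ chamber n, ∀ y i, hypRefl (n i) y ∈ chamber n →
      dist p x + dist (sheet s x) (sheet (!s) (hypRefl (n i) y)) < r → dist p y < r →
      dist (sheet s x) (sheet (!s) (hypRefl (n i) y)) = dist x y := by
    intro x hxT y i hyT hx hy
    obtain ⟨l, hl⟩ := hS.exists_eq s x hxT _ hyT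
    have h1 := dist_triangle (hypRefl (n l) p) (hypRefl (n l) x) (hypRefl (n i) y)
    rw [dist_hypRefl_hypRefl (hn.unit l), ← hl] at h1
    obtain rfl : l = i := by
      refine hr.eq_of_dist_lt (h1.trans_lt hx) ?_
      rwa [dist_hypRefl_hypRefl (hn.unit i)]
    rw [hl, dist_hypRefl_hypRefl (hn.unit l)]
  rcases hX with ⟨hxT, rfl⟩ | ⟨i, hxT, rfl⟩ <;> rcases hY with ⟨hyT, rfl⟩ | ⟨j, hyT, rfl⟩
  · exact hS.dist_same s x hxT y hyT
  · exact mixed x hxT y j hyT hx (by linarith)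
  · rw [dist_comm, dist_comm x]
    rw [dist_comm (sheet _ _)] at hy
    exact mixed y hyT x i hxT hy (by linarith)
  · rw [hS.dist_same _ _ hxT _ hyT] at hx hy h0 ⊢
    obtain rfl : i = j := by
      have h1 := dist_triangle (hypRefl (n i) p) (hypRefl (n i) x) (hypRefl (n j) y)
      rw [dist_hypRefl_hypRefl (hn.unit i)] at h1
      refine hr.eq_of_dist_lt (h1.trans_lt hx) ?_
      rw [dist_hypRefl_hypRefl (hn.unit j)]
      linarith
    exact dist_hypRefl_hypRefl (hn.unit i) _ _

theorem IsDouble.dist_centre_of_unfolds (hS : IsDouble n sheet) (hn : NonobtuseSides n) {s : Bool}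
    {p : UpperHalfPlane} (hp : p ∈ chamber n) {r : ℝ} (hr : Separated n p r)
    {x : UpperHalfPlane} {X : S} (hX : Unfolds n sheet s x X) (hx : dist p x < r) :
    dist (sheet s p) X = dist p x := by
  rcases hX with ⟨hxT, rfl⟩ | ⟨i, hxT, rfl⟩
  · exact hS.dist_same s p hp x hxT
  · obtain ⟨l, hl⟩ := hS.exists_eq s p hp _ hxT
    have h1 := hS.dist_le s p hp _ hxT i
    rw [dist_hypRefl_hypRefl (hn.unit i)] at h1
    obtain rfl : l = i := by
      refine hr.eq_of_dist_lt (x := hypRefl (n i) x) (by linarith) ?_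
      rwa [dist_hypRefl_hypRefl (hn.unit i)]
    rw [hl, dist_hypRefl_hypRefl (hn.unit l)]

theorem IsDouble.exists_unfolds_of_dist_lt (hS : IsDouble n sheet) (hn : NonobtuseSides n)
    (s : Bool) {p : UpperHalfPlane} (hp : p ∈ chamber n) {r : ℝ} {X : S}
    (hX : dist (sheet s p) X < r) : ∃ x, dist p x < r ∧ Unfolds n sheet s x X := by
  obtain ⟨s', w, hw, rfl⟩ := hS.surj X
  by_cases h : s' = s
  · subst h
    rw [hS.dist_same _ _ hp _ hw] at hX
    exact ⟨w, hX, Or.inl ⟨hw, rfl⟩⟩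
  · obtain rfl : s' = !s := by cases s <;> cases s' <;> simp_all
    obtain ⟨l, hl⟩ := hS.exists_eq s p hp w hw
    refine ⟨hypRefl (n l) w, ?_, Or.inr ⟨l, ?_, ?_⟩⟩
    · rwa [← dist_hypRefl_left (hn.unit l), ← hl]
    · rwa [hypRefl_hypRefl (hn.unit l)]
    · rw [hypRefl_hypRefl (hn.unit l)]

/-- If the mirror images of `p` are at mutual distances at least `2 r`, the ball of radius `r`
around `p` in the double is an embedded disk. -/
theorem IsDouble.mem_embeddedDiskRadii (hS : IsDouble n sheet) (hn : NonobtuseSides n)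
    (s : Bool) {p : UpperHalfPlane} (hp : p ∈ chamber n) {r : ℝ} (hr0 : 0 ≤ r)
    (hr : Separated n p r) : r ∈ embeddedDiskRadii (sheet s p) := by
  have hex : ∀ x : Metric.ball p r, ∃ X : Metric.ball (sheet s p) r,
      Unfolds n sheet s (x : UpperHalfPlane) (X : S) := by
    rintro ⟨x, hx⟩
    rw [Metric.mem_ball, dist_comm] at hx
    obtain ⟨X, hX⟩ := exists_unfolds hn sheet s hp hr hx
    refine ⟨⟨X, ?_⟩, hX⟩
    rw [Metric.mem_ball, dist_comm, hS.dist_centre_of_unfolds hn hp hr hX hx]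
    exact hx
  choose f hf using hex
  have hxr : ∀ x : Metric.ball p r, dist p x < r := fun x => by
    rw [dist_comm]; exact x.2
  have hcen : ∀ x, dist (sheet s p) (f x) = dist p x :=
    fun x => hS.dist_centre_of_unfolds hn hp hr (hf x) (hxr x)
  have hle : ∀ x y : Metric.ball p r, dist p x + dist x y < r → dist p y + dist x y < r →
      dist (f x) (f y) ≤ dist x y :=
    fun x y h1 h2 => hS.dist_le_of_unfolds hn hp hr (hf x) (hf y) h1 h2
  have heq : ∀ x y : Metric.ball p r, dist p x + dist (f x) (f y) < r →
      dist p y + dist (f x) (f y) < r → dist (f x) (f y) = dist x y :=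
    fun x y h1 h2 => hS.dist_eq_of_unfolds hn hr (hf x) (hf y) h1 h2
  have hinj : Function.Injective f := by
    intro x y hxy
    have := heq x y (by rw [hxy, dist_self, add_zero]; exact hxr x)
      (by rw [hxy, dist_self, add_zero]; exact hxr y)
    rw [hxy, dist_self] at this
    exact dist_eq_zero.1 this.symm
  have hsurj : Function.Surjective f := by
    rintro ⟨X, hX⟩
    rw [Metric.mem_ball, dist_comm] at hX
    obtain ⟨x, hx, hxX⟩ := hS.exists_unfolds_of_dist_lt hn s hp hX
    refine ⟨⟨x, by rwa [Metric.mem_ball, dist_comm]⟩, ?_⟩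
    set x' : Metric.ball p r := ⟨x, by rwa [Metric.mem_ball, dist_comm]⟩
    -- The chosen unfolding of `x` need not be the given one, but two unfoldings of one point are at
    -- distance `0`.
    have h1 : dist (f x' : S) X ≤ dist x x := hS.dist_le_of_unfolds hn hp hr (hf x') hxX
      (by simpa using hx) (by simpa using hx)
    rw [dist_self] at h1
    exact Subtype.ext (dist_le_zero.1 h1)
  have hlip : ∀ x y : Metric.ball p r, dist p x + 2 * dist x y < r →
      dist (f x) (f y) = dist x y := by
    intro x y h
    have h0 : 0 ≤ dist x y := dist_nonneg
    have h1 : dist p y ≤ dist p x + dist x y := dist_triangle _ _ _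
    have h2 := hle x y (by linarith) (by linarith)
    exact heq x y (by linarith) (by linarith)
  let e := Equiv.ofBijective f ⟨hinj, hsurj⟩
  have hfe : ∀ x, e x = f x := fun x => rfl
  have hcont : Continuous e := by
    rw [Metric.continuous_iff]
    intro x ε hε
    refine ⟨min ε ((r - dist p x) / 2), lt_min hε (by linarith [hxr x]), fun y hy => ?_⟩
    rw [lt_min_iff, dist_comm] at hy
    rw [dist_comm, hfe, hfe, hlip x y (by linarith)]
    exact hy.1
  have hcont' : Continuous e.symm := by
    rw [Metric.continuous_iff]
    intro X ε hε
    obtain ⟨x, rfl⟩ := e.surjective X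
    refine ⟨min ε ((r - dist p x) / 2), lt_min hε (by linarith [hxr x]), fun Y hY => ?_⟩
    obtain ⟨y, rfl⟩ := e.surjective Y
    rw [lt_min_iff, dist_comm] at hY
    rw [Equiv.symm_apply_apply, Equiv.symm_apply_apply]
    rw [hfe, hfe] at hY
    have h0 : 0 ≤ dist (f x) (f y) := dist_nonneg
    -- Distances from the centre are preserved, so this triangle inequality can be taken in the
    -- surface, before `f` is known to be isometric there.
    have h1 : dist p y ≤ dist p x + dist (f x) (f y) := by
      rw [← hcen, ← hcen]
      exact dist_triangle _ _ _
    rw [dist_comm, ← heq x y (by linarith) (by linarith)]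
    exact hY.1
  refine ⟨hr0, p, ⟨e, hcont, hcont'⟩, ?_, ?_⟩
  · rintro x hx
    have h1 := hcen x
    rw [hx, dist_self] at h1
    exact (dist_eq_zero.1 h1).symm
  · intro x
    -- With `ε` this radius, `dist p y + 2 dist y w` is below `dist p x + ε + 4 ε`.
    refine ⟨(r - dist p x) / 6, by linarith [hxr x], fun y w hy hw => hlip y w ?_⟩
    have h1 : dist p y ≤ dist p x + dist y x := by
      rw [dist_comm y x]; exact dist_triangle _ _ _
    have h2 := dist_triangle_right y w x
    linarith [hxr x]

end Double

/-! ## The Gram determinant -/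

/-- Minus the determinant of the Gram matrix of the normals of a triangle whose angles have the
cosines `a`, `b`, `c`. -/
def cosDet (a b c : ℝ) : ℝ := a ^ 2 + b ^ 2 + c ^ 2 + 2 * a * b * c - 1

/-- The quadratic form of the adjugate of the Gram matrix of the normals of a triangle whose
angles have the cosines `a`, `b`, `c`. -/
def cosForm (a b c : ℝ) (u : Fin 3 → ℝ) : ℝ :=
  (1 - a ^ 2) * u 0 ^ 2 + (1 - b ^ 2) * u 1 ^ 2 + (1 - c ^ 2) * u 2 ^ 2 +
    2 * (c + a * b) * (u 0 * u 1) + 2 * (b + a * c) * (u 0 * u 2) + 2 * (a + b * c) * (u 1 * u 2)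

/-- If `G` is the Gram matrix of three vectors and `m` the vector of their pairings with `v`, then
`mᵀ adj(G) m = det(G) ⟨v, v⟩`; the sign on the right comes from `geodPairing` being minus `mink`. -/
theorem adjugate_gram_form (x y z v : ℝ × ℝ × ℝ) :
    (geodPairing y y * geodPairing z z - geodPairing y z ^ 2) * mink (sharp x) v ^ 2 +
      (geodPairing x x * geodPairing z z - geodPairing x z ^ 2) * mink (sharp y) v ^ 2 +
      (geodPairing x x * geodPairing y y - geodPairing x y ^ 2) * mink (sharp z) v ^ 2 +
      2 * (geodPairing y z * geodPairing x z - geodPairing z z * geodPairing x y) *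
        (mink (sharp x) v * mink (sharp y) v) +
      2 * (geodPairing y z * geodPairing x y - geodPairing y y * geodPairing x z) *
        (mink (sharp x) v * mink (sharp z) v) +
      2 * (geodPairing x y * geodPairing x z - geodPairing x x * geodPairing y z) *
        (mink (sharp y) v * mink (sharp z) v) =
    (geodPairing x x * geodPairing y z ^ 2 + geodPairing y y * geodPairing x z ^ 2 +
      geodPairing z z * geodPairing x y ^ 2 -
      2 * geodPairing x y * geodPairing x z * geodPairing y z -
      geodPairing x x * geodPairing y y * geodPairing z z) * mink v v := by
  simp only [geodPairing, mink, sharp]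
  ring

theorem NonobtuseSides.cosForm_eq {n : Fin 3 → ℝ × ℝ × ℝ} (hn : NonobtuseSides n)
    (v : ℝ × ℝ × ℝ) :
    cosForm (-geodPairing (n 1) (n 2)) (-geodPairing (n 0) (n 2)) (-geodPairing (n 0) (n 1))
      (fun i => -mink (sharp (n i)) v) =
    cosDet (-geodPairing (n 1) (n 2)) (-geodPairing (n 0) (n 2)) (-geodPairing (n 0) (n 1)) *
      mink v v := by
  have h := adjugate_gram_form (n 0) (n 1) (n 2) v
  simp only [hn.unit] at h
  simp only [cosForm, cosDet]
  linear_combination h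

/-- The sides are those of a nondegenerate triangle. -/
structure HypSides (n : Fin 3 → ℝ × ℝ × ℝ) : Prop extends NonobtuseSides n where
  det_pos : 0 < cosDet (-geodPairing (n 1) (n 2)) (-geodPairing (n 0) (n 2))
    (-geodPairing (n 0) (n 1))

/-- The three heights of a point of a surface obey one relation: the image of the hyperboloid in
height coordinates. -/
theorem HypSides.cosForm_ht {n : Fin 3 → ℝ × ℝ × ℝ} (hn : HypSides n) (z : UpperHalfPlane) :
    cosForm (-geodPairing (n 1) (n 2)) (-geodPairing (n 0) (n 2)) (-geodPairing (n 0) (n 1))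
      (fun i => ht (n i) z) =
    cosDet (-geodPairing (n 1) (n 2)) (-geodPairing (n 0) (n 2)) (-geodPairing (n 0) (n 1)) := by
  have := hn.cosForm_eq (hypVec z)
  rwa [mink_hypVec_self, mul_one] at this

theorem HypSides.one_sub_sq_mul {n : Fin 3 → ℝ × ℝ × ℝ} (hn : HypSides n) {i j k : Fin 3}
    (hij : i ≠ j) (hki : k ≠ i) (hkj : k ≠ j) {z : UpperHalfPlane} (hi : ht (n i) z = 0)
    (hj : ht (n j) z = 0) : 0 < (1 - geodPairing (n i) (n j) ^ 2) * ht (n k) z ^ 2 := by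
  have h := hn.cosForm_ht z
  have hD := hn.det_pos
  rw [← h] at hD
  simp only [cosForm] at hD
  fin_cases i <;> fin_cases j <;> fin_cases k <;> simp_all
  all_goals simpa only [geodPairing_comm (n 1) (n 0), geodPairing_comm (n 2) (n 0),
    geodPairing_comm (n 2) (n 1)] using hD

/-- With two heights zero, only the diagonal term of the third is left in `cosForm`, and it equals
the positive determinant. So neither factor vanishes: the angle at an actual vertex is positive, and
the third side misses it. -/
theorem HypSides.vertex {n : Fin 3 → ℝ × ℝ × ℝ} (hn : HypSides n) {i j : Fin 3} (hij : i ≠ j)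
    {z : UpperHalfPlane} (hi : ht (n i) z = 0) (hj : ht (n j) z = 0) :
    -1 < geodPairing (n i) (n j) ∧ ∀ k, k ≠ i → k ≠ j → ht (n k) z ≠ 0 := by
  constructor
  · obtain ⟨k, hki, hkj⟩ : ∃ k : Fin 3, k ≠ i ∧ k ≠ j := by
      clear * -; revert i j; decide
    have h := pos_of_mul_pos_left (hn.one_sub_sq_mul hij hki hkj hi hj) (sq_nonneg _)
    nlinarith [sq_nonneg (geodPairing (n i) (n j))]
  · intro k hki hkj h0
    have h := hn.one_sub_sq_mul hij hki hkj hi hj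
    simp [h0] at h

/-! ## Auxiliary facts for the upper bound -/

/-- Continuous induction along an interval. It serves to carry paths through a local isometry
without increasing their length. -/
theorem lipschitzWith_one_of_locally {X : Type*} [PseudoMetricSpace X] {σ : ℝ → X}
    (h : ∀ τ, ∃ ε > 0, ∀ τ', |τ' - τ| < ε → dist (σ τ) (σ τ') ≤ |τ - τ'|) :
    LipschitzWith 1 σ := by
  have hc : Continuous σ := by
    rw [Metric.continuous_iff]
    intro τ δ hδ
    obtain ⟨ε, hε, H⟩ := h τ
    refine ⟨min ε δ, lt_min hε hδ, fun τ' hτ' => ?_⟩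
    rw [Real.dist_eq, lt_min_iff] at hτ'
    rw [dist_comm]
    exact (H τ' hτ'.1).trans_lt (by rw [abs_sub_comm]; exact hτ'.2)
  have key : ∀ a b, a ≤ b → dist (σ a) (σ b) ≤ b - a := by
    intro a b hab
    have hs : Set.Icc a b ⊆ {τ | dist (σ a) (σ τ) ≤ τ - a} := by
      apply IsClosed.Icc_subset_of_forall_exists_gt
      · exact (isClosed_le (by fun_prop) (by fun_prop)).inter isClosed_Icc
      · simp
      · rintro x ⟨hx, -⟩ y hy
        obtain ⟨ε, hε, H⟩ := h x
        have hxy : x < y := hy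
        refine ⟨min y (x + ε / 2), ?_, lt_min hxy (by linarith), min_le_left _ _⟩
        have h1 : x < min y (x + ε / 2) := lt_min hxy (by linarith)
        have h2 : min y (x + ε / 2) ≤ x + ε / 2 := min_le_right _ _
        generalize min y (x + ε / 2) = w at h1 h2
        have h3 := H w (by rw [abs_of_pos (by linarith)]; linarith)
        rw [abs_sub_comm, abs_of_pos (by linarith)] at h3
        have hx' : dist (σ a) (σ x) ≤ x - a := hx
        change dist (σ a) (σ w) ≤ w - a
        linarith [dist_triangle (σ a) (σ x) (σ w)]
    exact hs ⟨hab, le_rfl⟩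
  refine LipschitzWith.of_dist_le_mul fun a b => ?_
  rw [NNReal.coe_one, one_mul, Real.dist_eq]
  rcases le_total a b with hab | hab
  · rw [abs_sub_comm, abs_of_nonneg (by linarith)]
    exact key a b hab
  · rw [dist_comm, abs_of_nonneg (by linarith)]
    exact key b a hab

/-- A segment is determined by its midpoint and one end. -/
theorem eq_of_midpoint_eq {p y y' x : UpperHalfPlane} {L : ℝ} (hy : dist p y = 2 * L)
    (hy' : dist p y' = 2 * L) (h : dist p x ≤ L) (h1 : dist y x ≤ L) (h2 : dist y' x ≤ L) :
    y = y' := by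
  obtain ⟨f, hf, -, -, hu⟩ := exists_midpoint p y
  obtain ⟨f', hf', -, -, hu'⟩ := exists_midpoint p y'
  obtain rfl := hu x (by linarith) (by linarith)
  obtain rfl := hu' x (by linarith) (by linarith)
  have hC : (2 * Real.cosh (dist p y / 2))⁻¹ ≠ 0 :=
    inv_ne_zero (mul_ne_zero two_ne_zero (Real.cosh_pos _).ne')
  rw [hf, hy', ← hy] at hf'
  exact hypVec_injective (add_left_cancel (smul_right_injective _ hC hf'))

/-- Comparing heights above side `i` gives `ht (n i) q = g * ht (n j) q` with `g ≤ 0`, while both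
heights are nonnegative. -/
theorem NonobtuseSides.ht_eq_zero_of_hypRefl_eq {n : Fin 3 → ℝ × ℝ × ℝ} (hn : NonobtuseSides n)
    {i j : Fin 3} (hij : i ≠ j) {q : UpperHalfPlane} (hq : q ∈ chamber n)
    (h : hypRefl (n i) q = hypRefl (n j) q) : ht (n i) q = 0 ∧ ht (n j) q = 0 := by
  have hg := hn.nonpos i j hij
  have h1 := congrArg (ht (n i)) h
  have h2 := congrArg (ht (n j)) h
  rw [ht_hypRefl_self (hn.unit i), ht_hypRefl (hn.unit j)] at h1
  rw [ht_hypRefl_self (hn.unit j), ht_hypRefl (hn.unit i), geodPairing_comm] at h2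
  have hi := hq i
  have hj := hq j
  constructor
  · nlinarith [mul_nonneg (neg_nonneg.2 hg) hj]
  · nlinarith [mul_nonneg (neg_nonneg.2 hg) hi]

/-- Near a vertex of the chamber there are points at the same distance from the two sides. -/
theorem HypSides.exists_near_vertex {n : Fin 3 → ℝ × ℝ × ℝ} (hn : HypSides n) {i j : Fin 3}
    (hij : i ≠ j) {μ : UpperHalfPlane} (hμ : μ ∈ chamber n) (hi : ht (n i) μ = 0)
    (hj : ht (n j) μ = 0) {δ : ℝ} (hδ : 0 < δ) :
    ∃ q ∈ chamber n, dist μ q < δ ∧ 0 < ht (n i) q ∧ ht (n j) q = ht (n i) q ∧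
      ∀ k, ht (n i) q ≤ ht (n k) q := by
  obtain ⟨hg, hk⟩ := hn.vertex hij hi hj
  set g := geodPairing (n i) (n j) with hgdef
  obtain ⟨k, hki, hkj, hkk⟩ : ∃ k : Fin 3, k ≠ i ∧ k ≠ j ∧ ∀ l, l = i ∨ l = j ∨ l = k := by
    clear * - hij; revert i j; decide
  have huk : 0 < ht (n k) μ := lt_of_le_of_ne (hμ k) (hk k hki hkj).symm
  set G := 1 + g - geodPairing (n k) (n i) - geodPairing (n k) (n j) with hG
  have c1 : ∀ᶠ h : ℝ in nhds 0, 0 < 1 - 2 * h ^ 2 * (1 + g) :=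
    (Continuous.tendsto (by fun_prop) 0).eventually_const_lt (by norm_num)
  have c2 : ∀ᶠ h : ℝ in nhds 0, h * G < ht (n k) μ :=
    (Continuous.tendsto (by fun_prop) 0).eventually_lt_const (by simpa using huk)
  have c3 : ∀ᶠ h : ℝ in nhds 0, (√(1 - 2 * h ^ 2 * (1 + g)))⁻¹ < Real.cosh δ := by
    have hc : ContinuousAt (fun h : ℝ => (√(1 - 2 * h ^ 2 * (1 + g)))⁻¹) 0 := by
      apply ContinuousAt.inv₀
      · fun_prop
      · norm_num
    apply hc.tendsto.eventually_lt_const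
    simpa using hδ.ne'
  obtain ⟨h, ⟨⟨h1, h2⟩, h3⟩, h0⟩ := (((c1.and c2).and c3).filter_mono
    (nhdsWithin_le_nhds (s := Set.Ioi 0))).and self_mem_nhdsWithin |>.exists
  have h0 : 0 < h := h0
  -- Moves from the vertex along the bisector. The three conditions on `h` keep `v` timelike, the
  -- third height the largest, and the new point within `δ`.
  set v := hypVec μ + h • (sharp (n i) + sharp (n j)) with hv
  have mi : mink (sharp (n i)) (hypVec μ) = 0 := neg_eq_zero.1 hi
  have mj : mink (sharp (n j)) (hypVec μ) = 0 := neg_eq_zero.1 hj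
  have hvv : mink v v = 1 - 2 * h ^ 2 * (1 + g) := by
    simp only [hv, mink_add_left, mink_add_right, mink_smul_left, mink_smul_right,
      mink_hypVec_self, mink_comm (hypVec μ), mi, mj, mink_sharp_sharp, hn.unit,
      geodPairing_comm (n j) (n i), ← hgdef]
    ring
  have hvμ : mink v (hypVec μ) = 1 := by
    simp only [hv, mink_add_left, mink_smul_left, mink_hypVec_self, mi, mj]
    ring
  obtain ⟨q, hq⟩ := exists_hypVec_eq (hvv ▸ h1) (hvμ ▸ one_pos)
  rw [hvv] at hq
  set N := √(1 - 2 * h ^ 2 * (1 + g)) with hN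
  have hN0 : 0 < N := Real.sqrt_pos.2 h1
  have hht : ∀ l, ht (n l) q =
      N⁻¹ * (ht (n l) μ + h * (geodPairing (n l) (n i) + geodPairing (n l) (n j))) := by
    intro l
    simp only [ht, hq, hv, mink_smul_right, mink_add_right, mink_sharp_sharp]
    ring
  have hqi : ht (n i) q = N⁻¹ * (h * (1 + g)) := by
    rw [hht, hi, hn.unit, ← hgdef, zero_add]
  have hqj : ht (n j) q = N⁻¹ * (h * (1 + g)) := by
    rw [hht, hj, hn.unit, geodPairing_comm (n j) (n i), ← hgdef]
    ring
  have hqk : N⁻¹ * (h * (1 + g)) ≤ ht (n k) q := by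
    rw [hht]
    gcongr
    rw [hG] at h2
    linarith
  have hpos : 0 < N⁻¹ * (h * (1 + g)) := by
    have : 0 < 1 + g := by linarith
    positivity
  have hall : ∀ l, ht (n i) q ≤ ht (n l) q := by
    intro l
    rcases hkk l with rfl | rfl | rfl
    · exact le_rfl
    · rw [hqi, hqj]
    · rwa [hqi]
  refine ⟨q, fun l => ?_, ?_, by rwa [hqi], by rw [hqi, hqj], hall⟩
  · exact le_trans (by rw [hqi]; exact hpos.le) (hall l)
  · have h4 : Real.cosh (dist μ q) < Real.cosh δ := by
      rw [cosh_dist_eq_mink, hq, mink_smul_right, mink_comm, hvμ, mul_one]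
      exact h3
    rwa [Real.cosh_lt_cosh, abs_of_nonneg dist_nonneg, abs_of_pos hδ] at h4

/-! ### Obstructions to larger embedded disks -/

section UpperBound

variable {n : Fin 3 → ℝ × ℝ × ℝ} {S : Type*} [MetricSpace S] {sheet : Bool → UpperHalfPlane → S}

/-- The vertices of the chamber have no neighbourhoods isometric to open subsets of the hyperbolic
plane. -/
theorem IsDouble.not_isometric_near_vertex (hS : IsDouble n sheet) (hn : HypSides n) (s : Bool)
    {i j : Fin 3} (hij : i ≠ j) {μ : UpperHalfPlane} (hμ : μ ∈ chamber n)
    (hi : ht (n i) μ = 0) (hj : ht (n j) μ = 0) {δ : ℝ} (hδ : 0 < δ) (χ : S → UpperHalfPlane) :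
    ¬ ∀ A B, dist A (sheet s μ) < δ → dist B (sheet s μ) < δ → dist (χ A) (χ B) = dist A B := by
  intro hχ
  have hn' := hn.toNonobtuseSides
  obtain ⟨q, hq, hqμ, hpos, hqij, hqk⟩ := hn.exists_near_vertex hij hμ hi hj (half_pos hδ)
  have hcosh : ∀ k l, ht (n k) q ≤ ht (n l) q →
      dist (hypRefl (n k) q) q ≤ dist (hypRefl (n l) q) q := by
    intro k l h
    rw [cosh_le_cosh_dist, mink_hypVec_hypRefl (hn.unit k), mink_hypVec_hypRefl (hn.unit l)]
    nlinarith [hq k]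
  set ρ := dist (hypRefl (n i) q) q / 2 with hρ
  have hρi : dist q (hypRefl (n i) q) = 2 * ρ := by rw [dist_comm, hρ]; ring
  have hρj : dist q (hypRefl (n j) q) = 2 * ρ := by
    rw [dist_comm, hρ, le_antisymm (hcosh j i hqij.le) (hcosh i j hqij.ge)]
    ring
  have hAB : dist (sheet s q) (sheet (!s) q) = 2 * ρ := by
    apply le_antisymm
    · rw [← hρi, dist_comm q]
      exact hS.dist_le s q hq q hq i
    · obtain ⟨l, hl⟩ := hS.exists_eq s q hq q hq
      rw [hl, ← hρi, dist_comm q]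
      exact hcosh i l (hqk l)
  have hμs : sheet (!s) μ = sheet s μ := (hS.sheet_eq hn' s hμ hi).symm
  have hA : dist (sheet s q) (sheet s μ) < δ := by
    rw [hS.dist_same _ _ hq _ hμ, dist_comm]; linarith
  have hB : dist (sheet (!s) q) (sheet s μ) < δ := by
    rw [← hμs, hS.dist_same _ _ hq _ hμ, dist_comm]; linarith
  -- The two copies of `q` are `2ρ` apart, and the feet of `q` on both sides are midpoints between
  -- them. Midpoints in the hyperbolic plane are unique, so the feet would coincide.
  have foot : ∀ k, dist q (hypRefl (n k) q) = 2 * ρ → ht (n k) μ = 0 →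
      ∃ x ∈ chamber n, dist q x ≤ ρ ∧ dist (hypRefl (n k) q) x ≤ ρ ∧
        dist (sheet s x) (sheet s μ) < δ ∧ dist (χ (sheet s q)) (χ (sheet s x)) ≤ ρ ∧
        dist (χ (sheet (!s) q)) (χ (sheet s x)) ≤ ρ := by
    intro k hk hkμ
    obtain ⟨x, hx, hx0, hdx⟩ := hn'.exists_crossing hq hq k
    rw [dist_comm (hypRefl (n k) q), hk, dist_comm x] at hdx
    have hx1 : dist q x ≤ ρ := by linarith
    have h1 : ρ ≤ dist q μ := by
      have h2 := dist_triangle q μ (hypRefl (n k) q)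
      rw [hk, ← dist_hypRefl_left (hn.unit k), hypRefl_eq_self (hn.unit k) hkμ,
        dist_comm μ q] at h2
      linarith
    have h3 : dist (sheet s x) (sheet s μ) < δ := by
      rw [hS.dist_same _ _ hx _ hμ]
      have := dist_triangle_left x μ q
      rw [dist_comm] at hqμ
      linarith
    refine ⟨x, hx, hx1, ?_, h3, ?_, ?_⟩
    · rwa [dist_hypRefl_left (hn.unit k), hypRefl_eq_self (hn.unit k) hx0]
    · rwa [hχ _ _ hA h3, hS.dist_same _ _ hq _ hx]
    · rwa [hχ _ _ hB h3, hS.sheet_eq hn' s hx hx0, hS.dist_same _ _ hq _ hx]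
  obtain ⟨x, hx, hx1, hx2, hx3, hx4, hx5⟩ := foot i hρi hi
  obtain ⟨y, hy, hy1, hy2, hy3, hy4, hy5⟩ := foot j hρj hj
  obtain ⟨f, -, -, -, hu⟩ := exists_midpoint (χ (sheet s q)) (χ (sheet (!s) q))
  rw [hχ _ _ hA hB, hAB, mul_div_cancel_left₀ _ two_ne_zero] at hu
  have hxy : χ (sheet s x) = χ (sheet s y) := (hu _ hx4 hx5).trans (hu _ hy4 hy5).symm
  have hxy' : x = y := by
    rw [← dist_eq_zero, ← hS.dist_same s x hx y hy, ← hχ _ _ hx3 hy3, hxy, dist_self]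
  subst hxy'
  have := hn'.ht_eq_zero_of_hypRefl_eq hij hq (eq_of_midpoint_eq hρi hρj hx1 hx2 hy2)
  exact hpos.ne' this.1

/-- The path in the double that unfolds to the segment from `p` to the mirror image of `q`. -/
theorem IsDouble.exists_path (hS : IsDouble n sheet) (hn : NonobtuseSides n) (s : Bool)
    {p q : UpperHalfPlane} (hp : p ∈ chamber n) (hq : q ∈ chamber n) (i : Fin 3) {L : ℝ}
    (hL : dist (hypRefl (n i) p) q = L) :
    ∃ Γ : ℝ → S, LipschitzWith 1 Γ ∧ Γ 0 = sheet s p ∧ Γ L = sheet (!s) q ∧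
      (∀ τ, dist (sheet s p) (Γ τ) ≤ L) ∧
      ∃ x, dist p x ≤ L / 2 ∧ dist (hypRefl (n i) q) x ≤ L / 2 ∧
        Unfolds n sheet s x (Γ (L / 2)) := by
  classical
  have hi := hn.unit i
  rw [dist_hypRefl_left hi] at hL
  have hL0 : 0 ≤ L := hL ▸ dist_nonneg
  obtain ⟨g, hg, h0, h1, hgL, hpos⟩ := exists_segment p (hypRefl (n i) q)
  rw [hL] at h1 hgL
  -- Heights are linear in the normal, so the height of a mirror image is a height for the reflected
  -- normal; this lets `hpos` be applied to reflected half-planes.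
  have refl_ht : ∀ w j, ht (n j) (hypRefl (n i) w) =
      ht (n j - (2 * geodPairing (n j) (n i)) • n i) w := by
    intro w j
    rw [ht_hypRefl hi, ht_eq, ht_eq, ht_eq]
    simp only [geodForm, Prod.fst_sub, Prod.snd_sub, Prod.smul_fst, Prod.smul_snd, smul_eq_mul]
    ring
  have hin : ∀ τ, 0 ≤ ht (n i) (g τ) → g τ ∈ chamber n := by
    intro τ h j
    rcases eq_or_ne j i with rfl | hj
    · exact h
    · apply hpos _ _ (hp j)
      rw [ht_hypRefl hi]
      nlinarith [hq j, mul_nonneg (neg_nonneg.2 (hn.nonpos j i hj)) (hq i)]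
  have hout : ∀ τ, ht (n i) (g τ) < 0 → hypRefl (n i) (g τ) ∈ chamber n := by
    intro τ h j
    rcases eq_or_ne j i with rfl | hj
    · rw [ht_hypRefl_self hi]; linarith
    · rw [refl_ht]
      apply hpos
      · rw [← refl_ht, ht_hypRefl hi]
        nlinarith [hp j, mul_nonneg (neg_nonneg.2 (hn.nonpos j i hj)) (hp i)]
      · rw [← refl_ht, hypRefl_hypRefl hi]
        exact hq j
  set Γ : ℝ → S := fun τ => if 0 ≤ ht (n i) (g τ) then sheet s (g τ)
    else sheet (!s) (hypRefl (n i) (g τ)) with hΓ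
  have hΓin : ∀ τ, 0 ≤ ht (n i) (g τ) → Γ τ = sheet s (g τ) := fun τ h => if_pos h
  have hΓout : ∀ τ, ht (n i) (g τ) < 0 → Γ τ = sheet (!s) (hypRefl (n i) (g τ)) :=
    fun τ h => if_neg (not_le.2 h)
  have hΓd : ∀ τ τ', dist (Γ τ) (Γ τ') ≤ dist (g τ) (g τ') := by
    intro τ τ'
    rcases le_or_gt 0 (ht (n i) (g τ)) with h | h <;>
      rcases le_or_gt 0 (ht (n i) (g τ')) with h' | h'
    · rw [hΓin τ h, hΓin τ' h', hS.dist_same _ _ (hin τ h) _ (hin τ' h')]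
    · rw [hΓin τ h, hΓout τ' h']
      refine (hS.dist_le s _ (hin τ h) _ (hout τ' h') i).trans ?_
      rw [dist_hypRefl_hypRefl hi]
    · rw [hΓout τ h, hΓin τ' h', dist_comm, dist_comm (g τ)]
      refine (hS.dist_le s _ (hin τ' h') _ (hout τ h) i).trans ?_
      rw [dist_hypRefl_hypRefl hi]
    · rw [hΓout τ h, hΓout τ' h', hS.dist_same _ _ (hout τ h) _ (hout τ' h'),
        dist_hypRefl_hypRefl hi]
  have hΓ0 : Γ 0 = sheet s p := by rw [hΓin 0 (by rw [h0]; exact hp i), h0]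
  refine ⟨Γ, ?_, hΓ0, ?_, ?_, g (L / 2), ?_, ?_, ?_⟩
  · refine LipschitzWith.of_dist_le_mul fun τ τ' => (hΓd τ τ').trans ?_
    exact hg.dist_le_mul τ τ'
  · rcases (hq i).eq_or_lt with h | h
    · have hq' : hypRefl (n i) q = q := hypRefl_eq_self hi h.symm
      rw [hΓin L (by rw [h1, hq', ← h]), h1, hq', hS.sheet_eq hn s hq h.symm]
    · rw [hΓout L (by rw [h1, ht_hypRefl_self hi]; linarith), h1, hypRefl_hypRefl hi]
  · intro τ
    have := hΓd 0 τ
    rw [h0, hΓ0] at this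
    exact this.trans (hgL τ)
  · have := hg.dist_le_mul 0 (L / 2)
    rw [h0, Real.dist_eq, zero_sub, abs_neg, abs_of_nonneg (by linarith)] at this
    simpa using this
  · have := hg.dist_le_mul L (L / 2)
    rw [h1, Real.dist_eq, sub_half, abs_of_nonneg (by linarith)] at this
    simpa using this
  · rcases le_or_gt 0 (ht (n i) (g (L / 2))) with h | h
    · exact Or.inl ⟨hin _ h, hΓin _ h⟩
    · exact Or.inr ⟨i, hout _ h, hΓout _ h⟩

/-- The radius of an embedded disk around `p` is at most half of the minimal distance of two mirror
images of `p`. -/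
theorem IsDouble.le_of_mem_embeddedDiskRadii (hS : IsDouble n sheet) (hn : HypSides n) (s : Bool)
    {p : UpperHalfPlane} (hp : p ∈ chamber n) {i j : Fin 3} (hij : i ≠ j) {L : ℝ}
    (hL : dist (hypRefl (n i) p) (hypRefl (n j) p) = 2 * L) (hsep : Separated n p L) {r : ℝ}
    (hr : r ∈ embeddedDiskRadii (sheet s p)) : r ≤ L := by
  by_contra! hLr
  obtain ⟨hr0, z, φ, hz, hloc⟩ := hr
  have hn' := hn.toNonobtuseSides
  have hL0 : 0 ≤ L := by linarith [dist_nonneg (x := hypRefl (n i) p) (y := hypRefl (n j) p)]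
  -- the local inverse of the isometry
  have hinv : ∀ Q : Metric.ball (sheet s p) r, ∃ ε > 0, ∀ A B : Metric.ball (sheet s p) r,
      dist A Q < ε → dist B Q < ε → dist (φ.symm A) (φ.symm B) = dist A B := by
    intro Q
    obtain ⟨ε, hε, H⟩ := hloc (φ.symm Q)
    obtain ⟨δ, hδ, hδ'⟩ := Metric.continuous_iff.1 φ.symm.continuous Q ε hε
    refine ⟨δ, hδ, fun A B hA hB => ?_⟩
    rw [← H _ _ (hδ' A hA) (hδ' B hB), φ.apply_symm_apply, φ.apply_symm_apply]
  obtain ⟨μ, hμv, hμi, hμj, -⟩ := exists_midpoint (hypRefl (n i) p) (hypRefl (n j) p)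
  rw [hL, mul_div_cancel_left₀ _ two_ne_zero] at hμv hμi hμj
  have hμht : ∀ m, ht m μ = (2 * Real.cosh L)⁻¹ *
      (ht m (hypRefl (n i) p) + ht m (hypRefl (n j) p)) := by
    intro m
    simp only [ht, hμv, mink_smul_right, mink_add_right]
    ring
  have hcosh := Real.cosh_pos L
  have hμi0 : 0 ≤ ht (n i) μ := by
    rw [hμht, ht_hypRefl_self (hn.unit i), ht_hypRefl (hn.unit j)]
    have := mul_nonneg (neg_nonneg.2 (hn.nonpos i j hij)) (hp j)
    apply mul_nonneg (by positivity)
    linarith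
  have hμj0 : 0 ≤ ht (n j) μ := by
    rw [hμht, ht_hypRefl_self (hn.unit j), ht_hypRefl (hn.unit i)]
    have := mul_nonneg (neg_nonneg.2 (hn.nonpos j i hij.symm)) (hp i)
    apply mul_nonneg (by positivity)
    linarith
  have hpμ : dist p μ ≤ L := by
    rw [← hμi]
    exact dist_le_dist_hypRefl_of_mem hn' hp hμi0
  -- If `μ` were beyond side `k`, then `R_k p` would be closer to `μ` than `p`, hence closer than
  -- `L`, contradicting its separation from `R_i p`.
  have hμ : μ ∈ chamber n := by
    intro k
    rcases eq_or_ne k i with rfl | hki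
    · exact hμi0
    by_contra! hneg
    have hpk : 0 < ht (n k) p := by
      refine lt_of_le_of_ne (hp k) fun h0 => ?_
      have h1 := hn.nonpos k i hki
      have h2 : ¬ ht (n k) μ < 0 := by
        rw [hμht, ht_hypRefl (hn.unit i), ht_hypRefl (hn.unit j), ← h0, not_lt]
        have h3 := mul_nonneg (neg_nonneg.2 h1) (hp i)
        rcases eq_or_ne k j with rfl | hkj
        · rw [← h0]; apply mul_nonneg (by positivity); linarith
        · have h4 := mul_nonneg (neg_nonneg.2 (hn.nonpos k j hkj)) (hp j)
          apply mul_nonneg (by positivity)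
          linarith
      exact h2 hneg
    have h1 : dist (hypRefl (n k) p) μ < dist p μ :=
      dist_hypRefl_lt_dist (hn.unit k) (mul_neg_of_pos_of_neg hpk hneg)
    have h2 := hsep i k hki.symm
    have h3 := dist_triangle_right (hypRefl (n i) p) (hypRefl (n k) p) μ
    linarith
  have hPQ : L ≤ dist (sheet s p) (sheet (!s) μ) := by
    obtain ⟨l, hl⟩ := hS.exists_eq s p hp μ hμ
    rw [hl]
    rcases eq_or_ne l i with rfl | hli
    · exact hμi.ge
    · have h2 := hsep i l hli.symm
      have h3 := dist_triangle_right (hypRefl (n i) p) (hypRefl (n l) p) μ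
      linarith
  have hQ : sheet (!s) μ ∈ Metric.ball (sheet s p) r := by
    rw [Metric.mem_ball, dist_comm]
    refine lt_of_le_of_lt (hS.dist_le s p hp μ hμ i) ?_
    rwa [hμi]
  by_cases hvert : ht (n i) μ = 0 ∧ ht (n j) μ = 0
  · obtain ⟨ε, hε, H⟩ := hinv ⟨_, hQ⟩
    classical
    obtain ⟨δ, hδ, hδ'⟩ := Metric.isOpen_iff.1 Metric.isOpen_ball _ hQ
    refine hS.not_isometric_near_vertex hn (!s) hij hμ hvert.1 hvert.2 (lt_min hε hδ)
      (fun A => if hA : A ∈ Metric.ball (sheet s p) r then φ.symm ⟨A, hA⟩ else z) ?_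
    intro A B hA hB
    rw [lt_min_iff] at hA hB
    have hA' : A ∈ Metric.ball (sheet s p) r := hδ' hA.2
    have hB' : B ∈ Metric.ball (sheet s p) r := hδ' hB.2
    simp only [hA', hB', dif_pos]
    exact H ⟨A, hA'⟩ ⟨B, hB'⟩ hA.1 hB.1
  · have hLpos : 0 < L := by
      refine lt_of_le_of_ne hL0 fun h0 => hvert ?_
      rw [← h0, dist_eq_zero] at hμi hμj
      have h1 := hn'.ht_eq_zero_of_hypRefl_eq hij hp (hμi.trans hμj.symm)
      rw [hypRefl_eq_self (hn.unit i) h1.1] at hμi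
      rwa [← hμi]
    have hP0 : sheet s p ∈ Metric.ball (sheet s p) r := Metric.mem_ball_self (by linarith)
    have hz0 : z ∈ Metric.ball z r := Metric.mem_ball_self (by linarith)
    have hsymmP : φ.symm ⟨_, hP0⟩ = ⟨z, hz0⟩ := by
      rw [Homeomorph.symm_apply_eq]
      exact Subtype.ext (hz ⟨z, hz0⟩ rfl).symm
    set m := φ.symm ⟨_, hQ⟩ with hm
    -- geodesics starting in the centre are not shortened
    have hzm : L ≤ dist z m := by
      obtain ⟨g, hg, h0, h1, hgL, -⟩ := exists_segment z m
      have hmr : dist z m < r := by rw [dist_comm]; exact m.2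
      have hmem : ∀ τ, g τ ∈ Metric.ball z r := fun τ => by
        rw [Metric.mem_ball, dist_comm]; exact (hgL τ).trans_lt hmr
      have hlip : LipschitzWith 1 fun τ => (φ ⟨g τ, hmem τ⟩ : S) := by
        apply lipschitzWith_one_of_locally
        intro τ
        obtain ⟨ε, hε, H⟩ := hloc ⟨g τ, hmem τ⟩
        refine ⟨ε, hε, fun τ' hτ' => ?_⟩
        have h2 : dist (g τ') (g τ) ≤ |τ' - τ| := by simpa [Real.dist_eq] using hg.dist_le_mul τ' τ
        have h3 := H ⟨g τ, hmem τ⟩ ⟨g τ', hmem τ'⟩ (by simpa using hε) (h2.trans_lt hτ')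
        rw [Subtype.dist_eq] at h3
        rw [h3, Subtype.dist_eq, dist_comm, abs_sub_comm]
        exact h2
      have h2 := hlip.dist_le_mul 0 (dist z m)
      have h3 : (φ ⟨g 0, hmem 0⟩ : S) = sheet s p := hz _ h0
      have h4 : (φ ⟨g (dist z m), hmem _⟩ : S) = sheet (!s) μ := by
        have : (⟨g (dist z m), hmem _⟩ : Metric.ball z r) = m := Subtype.ext h1
        rw [this, hm, φ.apply_symm_apply]
      rw [h3, h4, Real.dist_eq, zero_sub, abs_neg, abs_of_nonneg dist_nonneg, NNReal.coe_one,
        one_mul] at h2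
      exact hPQ.trans h2
    -- The path of length `L` through side `k` pulls back to a path from `z` to `m` of length at
    -- most `L ≤ dist z m`; thus its halfway point is sent to the midpoint of `z` and `m`, for `k =
    -- i` and for `k = j` alike.
    have hside : ∀ k, dist (hypRefl (n k) p) μ = L → ∃ X : Metric.ball (sheet s p) r,
        dist z (φ.symm X) ≤ L / 2 ∧ dist (m : UpperHalfPlane) (φ.symm X) ≤ L / 2 ∧
        ∃ x, dist p x ≤ L / 2 ∧ dist (hypRefl (n k) μ) x ≤ L / 2 ∧
          Unfolds n sheet s x (X : S) := by
      intro k hk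
      obtain ⟨Γ, hΓ, h0, h1, hΓL, x, hx⟩ := hS.exists_path hn' s hp hμ k hk
      have hmem : ∀ τ, Γ τ ∈ Metric.ball (sheet s p) r := fun τ => by
        rw [Metric.mem_ball, dist_comm]; exact (hΓL τ).trans_lt hLr
      have hlip : LipschitzWith 1 fun τ => (φ.symm ⟨Γ τ, hmem τ⟩ : UpperHalfPlane) := by
        apply lipschitzWith_one_of_locally
        intro τ
        obtain ⟨ε, hε, H⟩ := hinv ⟨Γ τ, hmem τ⟩
        refine ⟨ε, hε, fun τ' hτ' => ?_⟩
        have h2 : dist (Γ τ') (Γ τ) ≤ |τ' - τ| := by simpa [Real.dist_eq] using hΓ.dist_le_mul τ' τ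
        have h3 := H ⟨Γ τ, hmem τ⟩ ⟨Γ τ', hmem τ'⟩ (by simpa using hε) (h2.trans_lt hτ')
        rw [Subtype.dist_eq] at h3
        rw [h3, Subtype.dist_eq, dist_comm, abs_sub_comm]
        exact h2
      have e0 : φ.symm ⟨Γ 0, hmem 0⟩ = ⟨z, hz0⟩ := by
        rw [← hsymmP]; congr 1; exact Subtype.ext h0
      have e1 : φ.symm ⟨Γ L, hmem L⟩ = m := by
        rw [hm]; congr 1; exact Subtype.ext h1
      refine ⟨⟨Γ (L / 2), hmem _⟩, ?_, ?_, x, hx⟩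
      · have := hlip.dist_le_mul 0 (L / 2)
        rw [e0, Real.dist_eq, zero_sub, abs_neg, abs_of_nonneg (by linarith)] at this
        simpa using this
      · have := hlip.dist_le_mul L (L / 2)
        rw [e1, Real.dist_eq, sub_half, abs_of_nonneg (by linarith)] at this
        simpa using this
    obtain ⟨X, hX1, hX2, x, hx1, hx2, hxX⟩ := hside i hμi
    obtain ⟨Y, hY1, hY2, y, hy1, hy2, hyY⟩ := hside j hμj
    obtain ⟨f, -, -, -, hu⟩ := exists_midpoint z m
    have hXY : X = Y := by
      apply φ.symm.injective
      apply Subtype.ext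
      exact (hu _ (by linarith) (by linarith)).trans (hu _ (by linarith) (by linarith)).symm
    subst hXY
    have hxy : x = y := by
      have := hS.dist_eq_of_unfolds hn' hsep hxX hyY (by rw [dist_self]; linarith)
        (by rw [dist_self]; linarith)
      rw [dist_self] at this
      exact dist_eq_zero.1 this.symm
    subst hxy
    apply hvert
    apply hn'.ht_eq_zero_of_hypRefl_eq hij hμ
    refine eq_of_midpoint_eq (p := p) (x := x) (L := L / 2) ?_ ?_ hx1 hx2 hy2
    · rw [← dist_hypRefl_left (hn.unit i), hμi]; ring
    · rw [← dist_hypRefl_left (hn.unit j), hμj]; ring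

end UpperBound

/-! ## The injectivity radius of a double -/

/-- The squared hyperbolic sine of half of the distance of the mirror images, in two sides that
form an angle with cosine `c`, of a point with heights `x` and `y` above these sides. -/
def loopForm (c x y : ℝ) : ℝ := x ^ 2 + y ^ 2 + 2 * c * (x * y)

/-- The minimum of `loopForm` over the three pairs of sides of a triangle whose angles have the
cosines `a`, `b`, `c`. -/
def loopMin (a b c : ℝ) (u : Fin 3 → ℝ) : ℝ :=
  min (min (loopForm c (u 0) (u 1)) (loopForm b (u 0) (u 2))) (loopForm a (u 1) (u 2))

/-- Applying the reflection formula twice gives `cosh d = 1 + 2 loopForm`, while `cosh (2s) = 1 + 2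
sinh² s`. -/
theorem NonobtuseSides.dist_hypRefl_hypRefl_eq {n : Fin 3 → ℝ × ℝ × ℝ} (hn : NonobtuseSides n)
    {p : UpperHalfPlane} (hp : p ∈ chamber n) {i j : Fin 3} (hij : i ≠ j) :
    dist (hypRefl (n i) p) (hypRefl (n j) p) =
      2 * Real.arsinh √(loopForm (-geodPairing (n i) (n j)) (ht (n i) p) (ht (n j) p)) := by
  have h0 : 0 ≤ loopForm (-geodPairing (n i) (n j)) (ht (n i) p) (ht (n j) p) := by
    have := mul_nonneg (neg_nonneg.2 (hn.nonpos i j hij)) (mul_nonneg (hp i) (hp j))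
    simp only [loopForm]
    nlinarith [sq_nonneg (ht (n i) p), sq_nonneg (ht (n j) p)]
  apply dist_eq_of_mink_eq_cosh
  · have := Real.arsinh_nonneg_iff.2 (Real.sqrt_nonneg
      (loopForm (-geodPairing (n i) (n j)) (ht (n i) p) (ht (n j) p)))
    linarith
  · rw [Real.cosh_two_mul, Real.cosh_sq, Real.sinh_arsinh, Real.sq_sqrt h0,
      mink_hypVec_hypRefl (hn.unit i), mink_comm, mink_hypVec_hypRefl (hn.unit j),
      mink_hypVec_self, ht_hypRefl (hn.unit j)]
    simp only [loopForm]
    ring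

theorem loopForm_comm (c x y : ℝ) : loopForm c x y = loopForm c y x := by
  simp only [loopForm]; ring

theorem IsDouble.isGreatest_embeddedDiskRadii {n : Fin 3 → ℝ × ℝ × ℝ} {S : Type*} [MetricSpace S]
    {sheet : Bool → UpperHalfPlane → S} (hS : IsDouble n sheet) (hn : HypSides n) (s : Bool)
    {p : UpperHalfPlane} (hp : p ∈ chamber n) :
    IsGreatest (embeddedDiskRadii (sheet s p)) (Real.arsinh √(loopMin (-geodPairing (n 1) (n 2))
      (-geodPairing (n 0) (n 2)) (-geodPairing (n 0) (n 1)) fun i => ht (n i) p)) := by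
  have hn' := hn.toNonobtuseSides
  set m := loopMin (-geodPairing (n 1) (n 2)) (-geodPairing (n 0) (n 2))
    (-geodPairing (n 0) (n 1)) (fun i => ht (n i) p) with hm
  have hle : ∀ i j, i ≠ j →
      m ≤ loopForm (-geodPairing (n i) (n j)) (ht (n i) p) (ht (n j) p) := by
    have h01 : m ≤ loopForm (-geodPairing (n 0) (n 1)) (ht (n 0) p) (ht (n 1) p) :=
      (min_le_left _ _).trans (min_le_left _ _)
    have h02 : m ≤ loopForm (-geodPairing (n 0) (n 2)) (ht (n 0) p) (ht (n 2) p) :=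
      (min_le_left _ _).trans (min_le_right _ _)
    have h12 : m ≤ loopForm (-geodPairing (n 1) (n 2)) (ht (n 1) p) (ht (n 2) p) :=
      min_le_right _ _
    intro i j hij
    fin_cases i <;> fin_cases j <;> first | exact absurd rfl hij | assumption |
      (rw [geodPairing_comm, loopForm_comm]; assumption)
  have hex : ∃ i j, i ≠ j ∧
      m = loopForm (-geodPairing (n i) (n j)) (ht (n i) p) (ht (n j) p) := by
    rw [hm, loopMin]
    rcases min_choice (min (loopForm (-geodPairing (n 0) (n 1)) (ht (n 0) p) (ht (n 1) p))
      (loopForm (-geodPairing (n 0) (n 2)) (ht (n 0) p) (ht (n 2) p)))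
      (loopForm (-geodPairing (n 1) (n 2)) (ht (n 1) p) (ht (n 2) p)) with h | h
    · rcases min_choice (loopForm (-geodPairing (n 0) (n 1)) (ht (n 0) p) (ht (n 1) p))
        (loopForm (-geodPairing (n 0) (n 2)) (ht (n 0) p) (ht (n 2) p)) with h' | h'
      · exact ⟨0, 1, by decide, h.trans h'⟩
      · exact ⟨0, 2, by decide, h.trans h'⟩
    · exact ⟨1, 2, by decide, h⟩
  have hsep : Separated n p (Real.arsinh √m) := by
    intro i j hij
    rw [hn'.dist_hypRefl_hypRefl_eq hp hij]
    have := Real.arsinh_le_arsinh.2 (Real.sqrt_le_sqrt (hle i j hij))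
    linarith
  obtain ⟨i, j, hij, hmij⟩ := hex
  refine ⟨hS.mem_embeddedDiskRadii hn' s hp (Real.arsinh_nonneg_iff.2 (Real.sqrt_nonneg _)) hsep,
    fun r hr => hS.le_of_mem_embeddedDiskRadii hn s hp hij ?_ hsep hr⟩
  rw [hn'.dist_hypRefl_hypRefl_eq hp hij, hmij]

theorem IsDouble.injRadius_eq {n : Fin 3 → ℝ × ℝ × ℝ} {S : Type*} [MetricSpace S]
    {sheet : Bool → UpperHalfPlane → S} (hS : IsDouble n sheet) (hn : HypSides n) (s : Bool)
    {p : UpperHalfPlane} (hp : p ∈ chamber n) :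
    injRadius (sheet s p) = Real.arsinh √(loopMin (-geodPairing (n 1) (n 2))
      (-geodPairing (n 0) (n 2)) (-geodPairing (n 0) (n 1)) fun i => ht (n i) p) :=
  (hS.isGreatest_embeddedDiskRadii hn s hp).csSup_eq

/-! ## Points with prescribed heights -/

theorem mink_hypVec_ne_zero {v : ℝ × ℝ × ℝ} (hv : 0 < mink v v) (z : UpperHalfPlane) :
    mink v (hypVec z) ≠ 0 := by
  intro h
  have hy := z.im_pos
  have h1 : v.2.2 * z.im * mink v (hypVec z) =
      (mink v v + (v.2.2 * z.re - v.2.1) ^ 2 + (v.2.2 * z.im) ^ 2) / 2 := by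
    simp only [mink, hypVec]
    field_simp
    ring
  rw [h, mul_zero] at h1
  nlinarith [sq_nonneg (v.2.2 * z.re - v.2.1), sq_nonneg (v.2.2 * z.im)]

/-- The adjugate of the Gram matrix solves the linear system for a vector with heights `u`. The
relation `hQ` makes this vector a unit vector; its coefficients are nonnegative up to a common sign,
which puts it on the right sheet of the hyperboloid. -/
theorem HypSides.exists_ht_eq {n : Fin 3 → ℝ × ℝ × ℝ} (hn : HypSides n)
    (hle : ∀ i j, -1 ≤ geodPairing (n i) (n j)) {z₀ : UpperHalfPlane} (hz₀ : z₀ ∈ chamber n)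
    {u : Fin 3 → ℝ} (hu : ∀ i, 0 ≤ u i)
    (hQ : cosForm (-geodPairing (n 1) (n 2)) (-geodPairing (n 0) (n 2)) (-geodPairing (n 0) (n 1))
      u = cosDet (-geodPairing (n 1) (n 2)) (-geodPairing (n 0) (n 2))
        (-geodPairing (n 0) (n 1))) :
    ∃ z ∈ chamber n, ∀ i, ht (n i) z = u i := by
  have hD := hn.det_pos
  have hcf := hn.cosForm_eq
  have ha := neg_nonneg.2 (hn.nonpos 1 2 (by decide))
  have hb := neg_nonneg.2 (hn.nonpos 0 2 (by decide))
  have hc := neg_nonneg.2 (hn.nonpos 0 1 (by decide))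
  have ha1 : -geodPairing (n 1) (n 2) ≤ 1 := by linarith [hle 1 2]
  have hb1 : -geodPairing (n 0) (n 2) ≤ 1 := by linarith [hle 0 2]
  have hc1 : -geodPairing (n 0) (n 1) ≤ 1 := by linarith [hle 0 1]
  have h12 := mink_sharp_sharp (n 1) (n 2)
  have h02 := mink_sharp_sharp (n 0) (n 2)
  have h01 := mink_sharp_sharp (n 0) (n 1)
  generalize -geodPairing (n 1) (n 2) = a at *
  generalize -geodPairing (n 0) (n 2) = b at *
  generalize -geodPairing (n 0) (n 1) = c at *
  have hii : ∀ i, mink (sharp (n i)) (sharp (n i)) = -1 := fun i => by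
    rw [mink_sharp_sharp, hn.unit]
  set D := cosDet a b c with hDdef
  set x := (1 - a ^ 2) * u 0 + (c + a * b) * u 1 + (b + a * c) * u 2 with hx
  set y := (c + a * b) * u 0 + (1 - b ^ 2) * u 1 + (a + b * c) * u 2 with hy
  set w := (b + a * c) * u 0 + (a + b * c) * u 1 + (1 - c ^ 2) * u 2 with hw
  have hsq : ∀ e : ℝ, 0 ≤ e → e ≤ 1 → 0 ≤ 1 - e ^ 2 := fun e h0 h1 => by nlinarith
  have hxpos : 0 ≤ x := by
    have := hsq a ha ha1; have := hu 0; have := hu 1; have := hu 2; positivity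
  have hypos : 0 ≤ y := by
    have := hsq b hb hb1; have := hu 0; have := hu 1; have := hu 2; positivity
  have hwpos : 0 ≤ w := by
    have := hsq c hc hc1; have := hu 0; have := hu 1; have := hu 2; positivity
  set v : ℝ × ℝ × ℝ := (-D⁻¹) • (x • sharp (n 0) + y • sharp (n 1) + w • sharp (n 2)) with hv
  have hDne : D ≠ 0 := hD.ne'
  have hvu : ∀ i, -mink (sharp (n i)) v = u i := by
    intro i
    simp only [hv, mink_smul_right, mink_add_right]
    fin_cases i
    · simp only [Fin.zero_eta, hii, h01, h02]
      field_simp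
      rw [hx, hy, hw, hDdef, cosDet]
      ring
    · simp only [Fin.mk_one, hii, h12, mink_comm (sharp (n 1)) (sharp (n 0)), h01]
      field_simp
      rw [hx, hy, hw, hDdef, cosDet]
      ring
    · simp only [Fin.reduceFinMk, hii, mink_comm (sharp (n 2)), h12, h02]
      field_simp
      rw [hx, hy, hw, hDdef, cosDet]
      ring
  have hvv : mink v v = 1 := by
    have h := hcf v
    rw [funext hvu, hQ] at h
    exact (mul_right_eq_self₀.1 h.symm).resolve_right hDne
  have hvz : 0 < mink v (hypVec z₀) := by
    refine lt_of_le_of_ne ?_ (mink_hypVec_ne_zero (hvv ▸ one_pos) z₀).symm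
    have h1 : mink v (hypVec z₀) =
        D⁻¹ * (x * ht (n 0) z₀ + y * ht (n 1) z₀ + w * ht (n 2) z₀) := by
      simp only [hv, mink_smul_left, mink_add_left, ht]
      ring
    rw [h1]
    have := hz₀ 0; have := hz₀ 1; have := hz₀ 2
    positivity
  obtain ⟨z, hz⟩ := exists_hypVec_eq_of_unit hvv hvz
  have hzu : ∀ i, ht (n i) z = u i := fun i => by rw [ht, hz, hvu]
  exact ⟨z, fun i => by rw [hzu]; exact hu i, hzu⟩

/-! ## Triangular surfaces as doubles -/

/-- The three sides of the triangle with angles `t`. -/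
noncomputable def triSides (t : ℝ × ℝ × ℝ) : Fin 3 → ℝ × ℝ × ℝ := ![sideA t, sideB t, sideC]

theorem cos_mem_of_angle {x : ℝ} (hx : x ∈ Set.Icc 0 (Real.pi / 2)) :
    0 ≤ Real.cos x ∧ Real.cos x ≤ 1 :=
  ⟨Real.cos_nonneg_of_neg_pi_div_two_le_of_le (by linarith [hx.1, Real.pi_pos]) hx.2,
    Real.cos_le_one x⟩

theorem angleTriples_rotate {t : ℝ × ℝ × ℝ} (ht : t ∈ angleTriples) :
    (t.2.1, t.2.2, t.1) ∈ angleTriples := by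
  obtain ⟨h1, h2, h3, h⟩ := ht
  exact ⟨h2, h3, h1, by simp only; linarith⟩

/-- `cosDet` equals `(cos γ + cos α cos β)² - sin² α sin² β`, so positivity is the condition `α + β
+ γ < π`. -/
theorem cosDet_pos {t : ℝ × ℝ × ℝ} (ht : t ∈ angleTriples) :
    0 < cosDet (Real.cos t.1) (Real.cos t.2.1) (Real.cos t.2.2) := by
  have h1 := triK_gt ht
  have h2 := mul_nonneg (sin_nonneg_of_angle ht.1) (sin_nonneg_of_angle ht.2.1)
  have h3 : (Real.sin t.1 * Real.sin t.2.1) ^ 2 < triK t ^ 2 := by gcongr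
  rw [mul_pow, Real.sin_sq, Real.sin_sq] at h3
  simp only [triK, cosDet] at h3 ⊢
  linarith

theorem cos_add_cos_mul_cos_pos {t : ℝ × ℝ × ℝ} (ht : t ∈ angleTriples) :
    0 < Real.cos t.2.2 + Real.cos t.1 * Real.cos t.2.1 :=
  lt_of_le_of_lt (mul_nonneg (sin_nonneg_of_angle ht.1) (sin_nonneg_of_angle ht.2.1)) (triK_gt ht)

theorem triSides_pairings {t : ℝ × ℝ × ℝ} (ht : t ∈ angleTriples) :
    -geodPairing (triSides t 1) (triSides t 2) = Real.cos t.1 ∧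
      -geodPairing (triSides t 0) (triSides t 2) = Real.cos t.2.1 ∧
      -geodPairing (triSides t 0) (triSides t 1) = Real.cos t.2.2 := by
  simp [triSides, geodPairing_sideB_sideC, geodPairing_sideA_sideC, geodPairing_sideA_sideB ht]

theorem triSides_unit {t : ℝ × ℝ × ℝ} (ht : t ∈ angleTriples) (i : Fin 3) :
    geodPairing (triSides t i) (triSides t i) = 1 := by
  fin_cases i
  · exact geodPairing_sideA_self ht
  · exact geodPairing_sideB_self t
  · exact geodPairing_sideC_self

theorem triSides_mem_Icc {t : ℝ × ℝ × ℝ} (ht : t ∈ angleTriples) {i j : Fin 3} (hij : i ≠ j) :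
    geodPairing (triSides t i) (triSides t j) ∈ Set.Icc (-1) 0 := by
  obtain ⟨h12, h02, h01⟩ := triSides_pairings ht
  have ha := cos_mem_of_angle ht.1
  have hb := cos_mem_of_angle ht.2.1
  have hc := cos_mem_of_angle ht.2.2.1
  rw [← h12] at ha
  rw [← h02] at hb
  rw [← h01] at hc
  have key : ∀ g : ℝ, 0 ≤ -g ∧ -g ≤ 1 → g ∈ Set.Icc (-1) 0 := fun g hg =>
    ⟨by linarith [hg.2], by linarith [hg.1]⟩
  fin_cases i <;> fin_cases j <;> first | exact absurd rfl hij | (apply key; assumption) |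
    (apply key; rw [geodPairing_comm]; assumption)

theorem triSides_hypSides {t : ℝ × ℝ × ℝ} (ht : t ∈ angleTriples) : HypSides (triSides t) where
  unit := triSides_unit ht
  nonpos _ _ hij := (triSides_mem_Icc ht hij).2
  det_pos := by
    obtain ⟨h12, h02, h01⟩ := triSides_pairings ht
    rw [h12, h02, h01]
    exact cosDet_pos ht

theorem chamber_triSides (t : ℝ × ℝ × ℝ) : chamber (triSides t) = hypTriangle t := by
  ext z
  simp [chamber, hypTriangle, triSides, Fin.forall_fin_succ, ht_nonneg_iff]

theorem mem_triangleSides_iff {t : ℝ × ℝ × ℝ} (z : hypTriangle t) :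
    z ∈ triangleSides t ↔ ∃ i, ht (triSides t i) z = 0 := by
  simp [triangleSides, triSides, Fin.exists_fin_succ, ht_eq_zero_iff]

instance (t : angleTriples) : Nonempty (TriangularSurface t) :=
  ⟨Metric.toGlueL _ _ (triangleSides_nonempty t).some.1⟩

open Classical in
/-- The two copies of the triangle in the triangular surface. -/
noncomputable def triSheet (t : angleTriples) (s : Bool) (z : UpperHalfPlane) :
    TriangularSurface t :=
  if h : z ∈ hypTriangle t.1 then
    if s then Metric.toGlueL _ _ ⟨z, h⟩ else Metric.toGlueR _ _ ⟨z, h⟩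
  -- Junk value; `IsDouble` only looks at points of the chamber.
  else Classical.arbitrary _

theorem triSheet_true {t : angleTriples} (z : hypTriangle t.1) :
    triSheet t true z = Metric.toGlueL _ _ z := by
  simp [triSheet]

theorem triSheet_false {t : angleTriples} (z : hypTriangle t.1) :
    triSheet t false z = Metric.toGlueR _ _ z := by
  simp [triSheet]

theorem dist_triSheet_not {t : angleTriples} (s : Bool) (z w : hypTriangle t.1) :
    dist (triSheet t s z) (triSheet t (!s) w) =
      ⨅ x : triangleSides t.1, (dist z x.1 + dist w x.1) := by
  cases s
  · rw [Bool.not_false, triSheet_false, triSheet_true]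
    refine (add_zero _).trans ?_
    simp only [add_comm]
  · rw [Bool.not_true, triSheet_true, triSheet_false]
    exact add_zero _

/-- A path through a point of side `j` is no shorter than the distance from `R_j p` to `q`, because
`R_j` fixes that point; `exists_crossing` shows that each of these distances is attained inside the
side. Hence the infimum defining the glued metric is a minimum over three sides. -/
theorem triSheet_isDouble (t : angleTriples) : IsDouble (triSides t.1) (triSheet t) where
  surj X := by
    rw [chamber_triSides]
    obtain ⟨x, rfl⟩ : ∃ x, Quot.mk _ x = X := Quot.exists_rep X
    rcases x with x | x
    · exact ⟨true, x, x.2, triSheet_true x⟩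
    · exact ⟨false, x, x.2, triSheet_false x⟩
  dist_same s p hp q hq := by
    rw [chamber_triSides] at hp hq
    cases s
    · rw [triSheet_false ⟨p, hp⟩, triSheet_false ⟨q, hq⟩, (Metric.toGlueR_isometry _ _).dist_eq]
      rfl
    · rw [triSheet_true ⟨p, hp⟩, triSheet_true ⟨q, hq⟩, (Metric.toGlueL_isometry _ _).dist_eq]
      rfl
  dist_le s p hp q hq i := by
    obtain ⟨x, hx, hx0, hd⟩ := (triSides_hypSides t.2).exists_crossing hp hq i
    rw [chamber_triSides] at hp hq hx
    rw [dist_triSheet_not s ⟨p, hp⟩ ⟨q, hq⟩]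
    refine (ciInf_le ⟨0, ?_⟩ (⟨⟨x, hx⟩, (mem_triangleSides_iff _).2 ⟨i, hx0⟩⟩ :
      triangleSides t.1)).trans ?_
    · rintro _ ⟨y, rfl⟩
      positivity
    · rw [dist_comm x] at hd
      exact hd
  exists_eq s p hp q hq := by
    have hn := triSides_hypSides t.2
    obtain ⟨i, hi⟩ := Finite.exists_min fun i => dist (hypRefl (triSides t.1 i) p) q
    refine ⟨i, le_antisymm ?_ ?_⟩
    · obtain ⟨x, hx, hx0, hd⟩ := hn.exists_crossing hp hq i
      rw [chamber_triSides] at hp hq hx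
      rw [dist_triSheet_not s ⟨p, hp⟩ ⟨q, hq⟩]
      refine (ciInf_le ⟨0, ?_⟩ (⟨⟨x, hx⟩, (mem_triangleSides_iff _).2 ⟨i, hx0⟩⟩ :
        triangleSides t.1)).trans ?_
      · rintro _ ⟨y, rfl⟩
        positivity
      · rw [dist_comm x] at hd
        exact hd
    · rw [chamber_triSides] at hp hq
      rw [dist_triSheet_not s ⟨p, hp⟩ ⟨q, hq⟩]
      refine le_ciInf fun x => ?_
      obtain ⟨j, hj⟩ := (mem_triangleSides_iff _).1 x.2
      refine (hi j).trans ?_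
      refine (dist_triangle _ (x.1 : UpperHalfPlane) _).trans ?_
      rw [dist_hypRefl_left (hn.unit j), hypRefl_eq_self (hn.unit j) hj, dist_comm _ q]
      rfl

/-! ## The maximum of the injectivity radius -/

theorem loopForm_nonneg {c x y : ℝ} (hc : 0 ≤ c) (hx : 0 ≤ x) (hy : 0 ≤ y) :
    0 ≤ loopForm c x y := by
  unfold loopForm; positivity

theorem sqrt_loopForm_le {c x y : ℝ} (hc : c ≤ 1) (hx : 0 ≤ x) (hy : 0 ≤ y) :
    √(loopForm c x y) ≤ x + y := by
  rw [Real.sqrt_le_left (by positivity), loopForm]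
  nlinarith [mul_nonneg hx hy]

theorem loopMin_smul (a b c r : ℝ) (u : Fin 3 → ℝ) :
    loopMin a b c (r • u) = r ^ 2 * loopMin a b c u := by
  have h : ∀ e x y, loopForm e (r * x) (r * y) = r ^ 2 * loopForm e x y := fun e x y => by
    simp only [loopForm]; ring
  simp only [loopMin, Pi.smul_apply, smul_eq_mul, h]
  rw [mul_min_of_nonneg _ _ (sq_nonneg r), mul_min_of_nonneg _ _ (sq_nonneg r)]

theorem cosForm_smul (a b c r : ℝ) (u : Fin 3 → ℝ) :
    cosForm a b c (r • u) = r ^ 2 * cosForm a b c u := by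
  simp only [cosForm, Pi.smul_apply, smul_eq_mul]
  ring

theorem loopMin_nonneg {a b c : ℝ} (ha : 0 ≤ a) (hb : 0 ≤ b) (hc : 0 ≤ c) {u : Fin 3 → ℝ}
    (hu : ∀ i, 0 ≤ u i) : 0 ≤ loopMin a b c u :=
  le_min (le_min (loopForm_nonneg hc (hu 0) (hu 1)) (loopForm_nonneg hb (hu 0) (hu 2)))
    (loopForm_nonneg ha (hu 1) (hu 2))

/-- On the simplex, the square root of `loopMin` is dominated by `cosForm`. -/
theorem mul_sqrt_loopMin_le_cosForm {a b c k : ℝ} (ha : 0 ≤ a ∧ a ≤ 1) (hb : 0 ≤ b ∧ b ≤ 1)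
    (hc : 0 ≤ c ∧ c ≤ 1) (hk : 0 ≤ k) (hka : k ≤ a + b * c) (hkb : k ≤ b + a * c)
    (hkc : k ≤ c + a * b) {w : Fin 3 → ℝ} (hw : w ∈ stdSimplex ℝ (Fin 3)) :
    k * √(loopMin a b c w) ≤ cosForm a b c w := by
  obtain ⟨hw0, hw1⟩ := hw
  rw [Fin.sum_univ_three] at hw1
  set q := √(loopMin a b c w) with hq
  have h0 := hw0 0
  have h1 := hw0 1
  have h2 := hw0 2
  have q01 : q ≤ w 0 + w 1 := (Real.sqrt_le_sqrt ((min_le_left _ _).trans (min_le_left _ _))).trans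
    (sqrt_loopForm_le hc.2 h0 h1)
  have q02 : q ≤ w 0 + w 2 := (Real.sqrt_le_sqrt ((min_le_left _ _).trans (min_le_right _ _))).trans
    (sqrt_loopForm_le hb.2 h0 h2)
  have q12 : q ≤ w 1 + w 2 := (Real.sqrt_le_sqrt (min_le_right _ _)).trans
    (sqrt_loopForm_le ha.2 h1 h2)
  have hsq : ∀ e : ℝ, 0 ≤ e ∧ e ≤ 1 → 0 ≤ 1 - e ^ 2 := fun e h => by nlinarith [h.1, h.2]
  -- Weight each bound on `q` by the remaining coordinate and add; the weights sum to `1`.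
  have hqle : q ≤ 2 * (w 0 * w 1 + w 0 * w 2 + w 1 * w 2) := by
    have e0 := mul_le_mul_of_nonneg_left q12 h0
    have e1 := mul_le_mul_of_nonneg_left q02 h1
    have e2 := mul_le_mul_of_nonneg_left q01 h2
    have e3 : (w 0 + w 1 + w 2) * q = q := by rw [hw1, one_mul]
    linarith
  have s0 := mul_nonneg (hsq a ha) (sq_nonneg (w 0))
  have s1 := mul_nonneg (hsq b hb) (sq_nonneg (w 1))
  have s2 := mul_nonneg (hsq c hc) (sq_nonneg (w 2))
  have t0 := mul_le_mul_of_nonneg_right hkc (mul_nonneg h0 h1)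
  have t1 := mul_le_mul_of_nonneg_right hkb (mul_nonneg h0 h2)
  have t2 := mul_le_mul_of_nonneg_right hka (mul_nonneg h1 h2)
  have t3 := mul_le_mul_of_nonneg_left hqle hk
  simp only [cosForm]
  linarith

/-! ### Continuity and attainment of the maximum -/

/-- The quotient whose maximum over the simplex determines the maximum injectivity radius. -/
noncomputable def loopRatio (t : angleTriples) (w : stdSimplex ℝ (Fin 3)) : ℝ :=
  loopMin (Real.cos t.1.1) (Real.cos t.1.2.1) (Real.cos t.1.2.2) w /
    cosForm (Real.cos t.1.1) (Real.cos t.1.2.1) (Real.cos t.1.2.2) w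

/-- The smallest nondiagonal coefficient of `cosForm`. -/
noncomputable def minCoeff (t : angleTriples) : ℝ :=
  min (Real.cos t.1.1 + Real.cos t.1.2.1 * Real.cos t.1.2.2)
    (min (Real.cos t.1.2.1 + Real.cos t.1.1 * Real.cos t.1.2.2)
      (Real.cos t.1.2.2 + Real.cos t.1.1 * Real.cos t.1.2.1))

theorem minCoeff_pos (t : angleTriples) : 0 < minCoeff t := by
  have h1 := angleTriples_rotate t.2
  have h2 := angleTriples_rotate h1
  refine lt_min (cos_add_cos_mul_cos_pos h1) (lt_min ?_ (cos_add_cos_mul_cos_pos t.2))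
  rw [mul_comm (Real.cos t.1.1)]
  exact cos_add_cos_mul_cos_pos h2

theorem minCoeff_mul_le (t : angleTriples) (w : stdSimplex ℝ (Fin 3)) :
    minCoeff t * √(loopMin (Real.cos t.1.1) (Real.cos t.1.2.1) (Real.cos t.1.2.2) w) ≤
      cosForm (Real.cos t.1.1) (Real.cos t.1.2.1) (Real.cos t.1.2.2) w :=
  mul_sqrt_loopMin_le_cosForm (cos_mem_of_angle t.2.1) (cos_mem_of_angle t.2.2.1)
    (cos_mem_of_angle t.2.2.2.1) (minCoeff_pos t).le (min_le_left _ _)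
    ((min_le_right _ _).trans (min_le_left _ _)) ((min_le_right _ _).trans (min_le_right _ _)) w.2

theorem loopMin_cos_nonneg (t : angleTriples) {u : Fin 3 → ℝ} (hu : ∀ i, 0 ≤ u i) :
    0 ≤ loopMin (Real.cos t.1.1) (Real.cos t.1.2.1) (Real.cos t.1.2.2) u :=
  loopMin_nonneg (cos_mem_of_angle t.2.1).1 (cos_mem_of_angle t.2.2.1).1
    (cos_mem_of_angle t.2.2.2.1).1 hu

theorem loopRatio_nonneg (t : angleTriples) (w : stdSimplex ℝ (Fin 3)) : 0 ≤ loopRatio t w :=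
  div_nonneg (loopMin_cos_nonneg t w.2.1)
    ((mul_nonneg (minCoeff_pos t).le (Real.sqrt_nonneg _)).trans (minCoeff_mul_le t w))

/-- From `k √m ≤ Q` follows `m / Q ≤ √m / k`, a bound by a function that stays continuous where `Q`
vanishes. -/
theorem loopRatio_le (t : angleTriples) (w : stdSimplex ℝ (Fin 3)) :
    loopRatio t w ≤
      √(loopMin (Real.cos t.1.1) (Real.cos t.1.2.1) (Real.cos t.1.2.2) w) / minCoeff t := by
  have h1 := minCoeff_mul_le t w
  have hk := minCoeff_pos t
  have hm : 0 ≤ loopMin (Real.cos t.1.1) (Real.cos t.1.2.1) (Real.cos t.1.2.2) w :=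
    loopMin_cos_nonneg t w.2.1
  rw [loopRatio]
  set m := loopMin (Real.cos t.1.1) (Real.cos t.1.2.1) (Real.cos t.1.2.2) w
  set Q := cosForm (Real.cos t.1.1) (Real.cos t.1.2.1) (Real.cos t.1.2.2) w
  have hq := Real.sqrt_nonneg m
  have hQ : 0 ≤ Q := (mul_nonneg hk.le hq).trans h1
  rcases hQ.eq_or_lt with h | h
  · rw [← h, div_zero]; positivity
  · rw [div_le_div_iff₀ h hk]
    nlinarith [Real.mul_self_sqrt hm, mul_le_mul_of_nonneg_left h1 hq]

theorem continuous_simplex_coord (i : Fin 3) :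
    Continuous fun x : angleTriples × stdSimplex ℝ (Fin 3) => x.2 i :=
  (continuous_apply i).comp (continuous_subtype_val.comp continuous_snd)

theorem continuous_loopMin_cos : Continuous fun x : angleTriples × stdSimplex ℝ (Fin 3) =>
    loopMin (Real.cos x.1.1.1) (Real.cos x.1.1.2.1) (Real.cos x.1.1.2.2) x.2 := by
  have h0 := continuous_simplex_coord 0
  have h1 := continuous_simplex_coord 1
  have h2 := continuous_simplex_coord 2
  unfold loopMin loopForm
  fun_prop

theorem continuous_cosForm_cos : Continuous fun x : angleTriples × stdSimplex ℝ (Fin 3) =>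
    cosForm (Real.cos x.1.1.1) (Real.cos x.1.1.2.1) (Real.cos x.1.1.2.2) x.2 := by
  have h0 := continuous_simplex_coord 0
  have h1 := continuous_simplex_coord 1
  have h2 := continuous_simplex_coord 2
  unfold cosForm
  fun_prop

theorem continuous_minCoeff : Continuous minCoeff := by
  unfold minCoeff
  fun_prop

/-- Where `cosForm` vanishes, so does `loopMin`, and the ratio is squeezed to `0`, its value there
by the convention for division by zero. -/
theorem continuous_loopRatio :
    Continuous fun x : angleTriples × stdSimplex ℝ (Fin 3) => loopRatio x.1 x.2 := by
  rw [continuous_iff_continuousAt]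
  rintro ⟨t, w⟩
  by_cases hQ : cosForm (Real.cos t.1.1) (Real.cos t.1.2.1) (Real.cos t.1.2.2) w = 0
  · have hm : √(loopMin (Real.cos t.1.1) (Real.cos t.1.2.1) (Real.cos t.1.2.2) w) = 0 := by
      have h1 := minCoeff_mul_le t w
      rw [hQ] at h1
      have hk := minCoeff_pos t
      have := Real.sqrt_nonneg
        (loopMin (Real.cos t.1.1) (Real.cos t.1.2.1) (Real.cos t.1.2.2) w)
      nlinarith
    have h0 : loopRatio t w = 0 := by rw [loopRatio, hQ, div_zero]
    have hlim : Filter.Tendsto (fun x : angleTriples × stdSimplex ℝ (Fin 3) =>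
        √(loopMin (Real.cos x.1.1.1) (Real.cos x.1.1.2.1) (Real.cos x.1.1.2.2) x.2) /
          minCoeff x.1) (nhds (t, w)) (nhds 0) := by
      have hc : Continuous fun x : angleTriples × stdSimplex ℝ (Fin 3) =>
          √(loopMin (Real.cos x.1.1.1) (Real.cos x.1.1.2.1) (Real.cos x.1.1.2.2) x.2) /
            minCoeff x.1 :=
        continuous_loopMin_cos.sqrt.div (continuous_minCoeff.comp continuous_fst)
          fun x => (minCoeff_pos x.1).ne'
      have := hc.tendsto (t, w)
      simpa only [hm, zero_div] using this
    rw [ContinuousAt, h0]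
    exact tendsto_of_tendsto_of_tendsto_of_le_of_le tendsto_const_nhds hlim
      (fun x => loopRatio_nonneg x.1 x.2) fun x => loopRatio_le x.1 x.2
  · exact continuous_loopMin_cos.continuousAt.div continuous_cosForm_cos.continuousAt hQ

/-- The squared hyperbolic sine of the maximum injectivity radius. -/
noncomputable def maxLoop (t : angleTriples) : ℝ :=
  cosDet (Real.cos t.1.1) (Real.cos t.1.2.1) (Real.cos t.1.2.2) *
    sSup (loopRatio t '' Set.univ)

/-- The simplex is compact and independent of the angles, so the supremum of a jointly continuous
function is continuous. -/
theorem continuous_maxLoop : Continuous maxLoop := by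
  have h := isCompact_univ.continuous_sSup (f := loopRatio) continuous_loopRatio
  unfold maxLoop cosDet
  fun_prop

theorem loopMin_ht_le_maxLoop (t : angleTriples) {p : UpperHalfPlane}
    (hp : p ∈ chamber (triSides t.1)) :
    loopMin (Real.cos t.1.1) (Real.cos t.1.2.1) (Real.cos t.1.2.2)
      (fun i => ht (triSides t.1 i) p) ≤ maxLoop t := by
  have hQ := (triSides_hypSides t.2).cosForm_ht p
  obtain ⟨h12, h02, h01⟩ := triSides_pairings t.2
  rw [h12, h02, h01] at hQ
  have hD := cosDet_pos t.2
  rw [maxLoop]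
  set D := cosDet (Real.cos t.1.1) (Real.cos t.1.2.1) (Real.cos t.1.2.2)
  set u : Fin 3 → ℝ := fun i => ht (triSides t.1 i) p with hu
  have hσ : 0 < ∑ i, u i := by
    refine lt_of_le_of_ne (Finset.sum_nonneg fun i _ => hp i) fun h => ?_
    have h0 : ∀ i ∈ Finset.univ, u i = 0 :=
      (Finset.sum_eq_zero_iff_of_nonneg fun i _ => hp i).1 h.symm
    rw [← hQ, cosForm, h0 0 (Finset.mem_univ _), h0 1 (Finset.mem_univ _),
      h0 2 (Finset.mem_univ _)] at hD
    norm_num at hD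
  set σ := ∑ i, u i with hσdef
  let w : stdSimplex ℝ (Fin 3) := ⟨σ⁻¹ • u, fun i => by
    have := hp i
    simp only [Pi.smul_apply, smul_eq_mul, hu]
    positivity, by
    simp only [Pi.smul_apply, smul_eq_mul, ← Finset.mul_sum]
    exact inv_mul_cancel₀ hσ.ne'⟩
  have hw : loopRatio t w =
      loopMin (Real.cos t.1.1) (Real.cos t.1.2.1) (Real.cos t.1.2.2) u / D := by
    have hwu : (w : Fin 3 → ℝ) = σ⁻¹ • u := rfl
    rw [loopRatio, hwu, loopMin_smul, cosForm_smul, hQ, mul_div_mul_left]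
    positivity
  have hbdd : BddAbove (loopRatio t '' Set.univ) :=
    (isCompact_univ.image (continuous_loopRatio.comp (Continuous.prodMk_right t))).bddAbove
  have h1 : loopRatio t w ≤ sSup (loopRatio t '' Set.univ) :=
    le_csSup hbdd ⟨w, trivial, rfl⟩
  rw [hw, div_le_iff₀ hD] at h1
  linarith

theorem exists_loopMin_ht_eq_maxLoop (t : angleTriples) : ∃ p ∈ chamber (triSides t.1),
    loopMin (Real.cos t.1.1) (Real.cos t.1.2.1) (Real.cos t.1.2.2)
      (fun i => ht (triSides t.1 i) p) = maxLoop t := by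
  have ha := cos_mem_of_angle t.2.1
  have hb := cos_mem_of_angle t.2.2.1
  have hc := cos_mem_of_angle t.2.2.2.1
  have hD := cosDet_pos t.2
  -- The barycentre shows that the maximum is positive. So at a maximizer `cosForm` is nonzero: the
  -- maximum is not attained at an ideal vertex.
  let w₀ : stdSimplex ℝ (Fin 3) := ⟨fun _ => 1 / 3, fun _ => by norm_num, by simp⟩
  obtain ⟨w, -, hw, hmax⟩ := isCompact_univ.exists_sSup_image_eq_and_ge ⟨w₀, trivial⟩
    (continuous_loopRatio.comp (Continuous.prodMk_right t)).continuousOn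
  change sSup (loopRatio t '' Set.univ) = loopRatio t w at hw
  have hm₀ : 0 < loopMin (Real.cos t.1.1) (Real.cos t.1.2.1) (Real.cos t.1.2.2) w₀ := by
    have h : ∀ e : ℝ, 0 ≤ e → 0 < loopForm e (1 / 3) (1 / 3) := fun e he => by
      unfold loopForm; positivity
    exact lt_min (lt_min (h _ hc.1) (h _ hb.1)) (h _ ha.1)
  have hpos : 0 < loopRatio t w := by
    refine lt_of_lt_of_le (div_pos hm₀ ?_) (hmax w₀ trivial)
    exact lt_of_lt_of_le (mul_pos (minCoeff_pos t) (Real.sqrt_pos.2 hm₀)) (minCoeff_mul_le t w₀)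
  have hQ : 0 < cosForm (Real.cos t.1.1) (Real.cos t.1.2.1) (Real.cos t.1.2.2) w := by
    refine lt_of_le_of_ne ((mul_nonneg (minCoeff_pos t).le (Real.sqrt_nonneg _)).trans
      (minCoeff_mul_le t w)) fun h => ?_
    rw [loopRatio, ← h, div_zero] at hpos
    exact hpos.false
  obtain ⟨h12, h02, h01⟩ := triSides_pairings t.2
  rw [maxLoop, hw, loopRatio]
  set D := cosDet (Real.cos t.1.1) (Real.cos t.1.2.1) (Real.cos t.1.2.2) with hDdef
  set Q := cosForm (Real.cos t.1.1) (Real.cos t.1.2.1) (Real.cos t.1.2.2) w with hQdef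
  obtain ⟨z, hz, hzu⟩ := (triSides_hypSides t.2).exists_ht_eq
    (fun i j => by
      rcases eq_or_ne i j with rfl | hij
      · rw [triSides_unit t.2]; norm_num
      · exact (triSides_mem_Icc t.2 hij).1)
    (z₀ := ((triangleSides_nonempty t).some.1 : UpperHalfPlane))
    (by rw [chamber_triSides]; exact (triangleSides_nonempty t).some.1.2)
    -- Rescaled so that `cosForm` takes the value `D`, as it must for the heights of a point.
    (u := √(D / Q) • (w : Fin 3 → ℝ))
    (fun i => mul_nonneg (Real.sqrt_nonneg _) (w.2.1 i))
    (by
      rw [h12, h02, h01, cosForm_smul, Real.sq_sqrt (by positivity), ← hQdef, ← hDdef]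
      field_simp)
  refine ⟨z, hz, ?_⟩
  rw [funext hzu, loopMin_smul, Real.sq_sqrt (by positivity)]
  field_simp

theorem triSheet_injRadius (t : angleTriples) (s : Bool) {p : UpperHalfPlane}
    (hp : p ∈ chamber (triSides t.1)) :
    injRadius (triSheet t s p) = Real.arsinh √(loopMin (Real.cos t.1.1) (Real.cos t.1.2.1)
      (Real.cos t.1.2.2) fun i => ht (triSides t.1 i) p) := by
  obtain ⟨h12, h02, h01⟩ := triSides_pairings t.2
  rw [(triSheet_isDouble t).injRadius_eq (triSides_hypSides t.2) s hp, h12, h02, h01]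

theorem isGreatest_range_injRadius (t : angleTriples) :
    IsGreatest (Set.range (injRadius : TriangularSurface t → ℝ)) (Real.arsinh √(maxLoop t)) := by
  constructor
  · obtain ⟨p, hp, h⟩ := exists_loopMin_ht_eq_maxLoop t
    exact ⟨triSheet t true p, by rw [triSheet_injRadius t true hp, h]⟩
  · rintro _ ⟨X, rfl⟩
    obtain ⟨s, p, hp, rfl⟩ := (triSheet_isDouble t).surj X
    rw [triSheet_injRadius t s hp]
    exact Real.arsinh_le_arsinh.2 (Real.sqrt_le_sqrt (loopMin_ht_le_maxLoop t hp))

theorem maxInjRadius_eq (t : angleTriples) :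
    maxInjRadius (TriangularSurface t) = Real.arsinh √(maxLoop t) :=
  (isGreatest_range_injRadius t).csSup_eq

theorem mainTheorem10 :
    (∀ t : angleTriples,
      (∀ p : TriangularSurface t, IsGreatest (embeddedDiskRadii p) (injRadius p)) ∧
      IsGreatest (Set.range (injRadius : TriangularSurface t → ℝ))
        (maxInjRadius (TriangularSurface t))) ∧
    Continuous (fun t : angleTriples => maxInjRadius (TriangularSurface t)) := by
  refine ⟨fun t => ⟨fun X => ?_, ?_⟩, ?_⟩
  · obtain ⟨s, p, hp, rfl⟩ := (triSheet_isDouble t).surj X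
    rw [(triSheet_isDouble t).injRadius_eq (triSides_hypSides t.2) s hp]
    exact (triSheet_isDouble t).isGreatest_embeddedDiskRadii (triSides_hypSides t.2) s hp
  · rw [maxInjRadius_eq]
    exact isGreatest_range_injRadius t
  · simp only [maxInjRadius_eq]
    exact Real.continuous_arsinh.comp continuous_maxLoop.sqrt
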